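/- Conventions. For symmetric real $2\times2$ matrices $M,N$, say that $M,N$ are compatible if $\operatorname{rank}(M-N+S)\le 1$ for some skew-symmetric $S$ (incompatible otherwise), and rank-one compatible if $\operatorname{rank}(M-N)\le1$. Write $e(M)=\tfrac12(M+M^T)$, $\langle\cdot,\cdot\rangle$ for the Frobenius inner product, and $C(\cdot)$ for the convex hull. The symmetric lamination convex hull is $L^e(\mathcal U)=\bigcup_{i\ge0}L^{e,i}(\mathcal U)$, where $L^{e,0}(\mathcal U)=\mathcal U$ and $L^{e,i+1}(\mathcal U)$ is the set of all $\lambda A+(1-\lambda)B$ with $\lambda\in[0,1]$ and $A,B\in L^{e,i}(\mathcal U)$ compatible. A function $F:\mathbb R^{2\times2}\to\mathbb R$ is quasiconvex if it is Borel measurable, locally bounded, and $F(M)\le\frac1{|\Omega|}\int_\Omega F(M+D\varphi)\,dx$ for all $M$, all nonempty bounded open $\Omega\subset\mathbb R^2$ and all $\varphi\in C_c^\infty(\Omega,\mathbb R^2)$; $f:\mathbb R^{2\times2}_{sym}\to\mathbb R$ is symmetric quasiconvex if $f\circ e$ is quasiconvex. The symmetric quasiconvex hull $Q^e(\mathcal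 U)$ is the set of symmetric $A$ with $f(A)\le\sup_{\mathcal U}f$ for every symmetric quasiconvex $f$. Four wells are in a wedge configuration if they can be labelled $U_0,U_1,U_2,U_3$ so that $\{U_2,U_3\}$ is the only incompatible pair in $\{U_1,U_2,U_3\}$, $U_0$ lies in the relative interior of $C(\{U_1,U_2,U_3\})$, and $U_0$ is rank-one compatible with $U_2$ and with $U_3$. Theorem (four coplanar wells). Let $\mathcal U\subset\mathbb R^{2\times2}_{sym}$ be a set of four distinct wells with $\langle Q,U\rangle=\delta$ for all $U\in\mathcal U$, where $Q\in\mathbb R^{2\times2}_{sym}$, $\det Q<0$ and $\delta\in\mathbb R$. Assume that every well is compatible with at least one other well of $\mathcal U$, and that $\mathcal U$ is not in a wedge configuration. Let $\{V_1,V_2\}\ne\{W_1,W_2\}$ be two pairs of distinct wells of $\mathcal U$, each pair rank-one compatible, and put $D=C(\{V_1,V_2\})\cup C(\{W_1,W_2\})$. Suppose that one of the following holds: (1) $D$ is disconnected; (2) $D$ is connected and $\mathcal U\subset D$; (3) $\{V_1,V_2\}\cap\{W_1,W_2\}=\{V\}$ is a single well, and $D$ is contained either in the upper part $\{V+\xi\,a^\perp\otimes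 a^\perp+\eta\,n^\perp\otimes n^\perp:\xi\ge0\ge\eta\}$ or in the lower part $\{V+\xi\,a^\perp\otimes a^\perp+\eta\,n^\perp\otimes n^\perp:\eta\ge0\ge\xi\}$ of the planar compatible cone of $V$. Here $a,n$ are linearly independent unit vectors with $\langle Q,a^\perp\otimes a^\perp\rangle=\langle Q,n^\perp\otimes n^\perp\rangle=0$, and $v^\perp$ is the counter-clockwise rotation of $v$ by $\pi/2$. Then $L^e(\mathcal U)=Q^e(\mathcal U)$. Moreover, for each of (1), (2), (3) there is a set $\mathcal U$ as above satisfying it for which this common set is strictly contained in $C(\mathcal U)$. -/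

import Mathlib

open MeasureTheory Set
open scoped ContDiff Matrix

/-- Real `2 × 2` matrices. -/
abbrev Mat : Type := Matrix (Fin 2) (Fin 2) ℝ

/-- The symmetric part `e(M) = (M + Mᵀ) / 2`. -/
noncomputable def symPart (M : Mat) : Mat := (1 / 2 : ℝ) • (M + Mᵀ)

/-- `M` and `N` are compatible: `rank (M - N + S) ≤ 1` for some skew-symmetric `S`. -/
def Compatible (M N : Mat) : Prop := ∃ S : Mat, Sᵀ = -S ∧ (M - N + S).rank ≤ 1

/-- `M` and `N` are rank-one compatible: `rank (M - N) ≤ 1`. -/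
def RankOneCompatible (M N : Mat) : Prop := (M - N).rank ≤ 1

/-- The Frobenius inner product. -/
def frobInner (M N : Mat) : ℝ := (Mᵀ * N).trace

/-- The Jacobian matrix `(D φ x) i j = ∂ φ_i / ∂ x_j`. -/
noncomputable def gradMat (φ : (Fin 2 → ℝ) → (Fin 2 → ℝ)) (x : Fin 2 → ℝ) : Mat :=
  Matrix.of fun i j => fderiv ℝ φ x (Pi.single j 1) i

/-- Quasiconvexity of `F : ℝ^{2×2} → ℝ`: `F` is Borel measurable, locally bounded (equivalently,
bounded on compact sets), and `F M ≤ |Ω|⁻¹ ∫_Ω F (M + D φ)` for all `φ ∈ C_c^∞(Ω, ℝ²)`, for every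
nonempty bounded open set `Ω` (the condition does not depend on the choice of `Ω`). -/
structure IsQuasiconvex (F : Mat → ℝ) : Prop where
  borel : Measurable[borel Mat, borel ℝ] F
  locallyBounded : ∀ K : Set Mat, IsCompact K → ∃ C : ℝ, ∀ M ∈ K, |F M| ≤ C
  le_average : ∀ Ω : Set (Fin 2 → ℝ), IsOpen Ω → Ω.Nonempty → Bornology.IsBounded Ω →
    ∀ φ : (Fin 2 → ℝ) → (Fin 2 → ℝ),
      ContDiff ℝ ∞ φ → HasCompactSupport φ → tsupport φ ⊆ Ω →
      ∀ M : Mat, F M ≤ (volume.real Ω)⁻¹ * ∫ x in Ω, F (M + gradMat φ x)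

/-- `f` is symmetric quasiconvex if `f ∘ e` is quasiconvex. Only the restriction of `f` to the
symmetric matrices matters here. -/
def IsSymQuasiconvex (f : Mat → ℝ) : Prop := IsQuasiconvex fun M => f (symPart M)

/-- The symmetric quasiconvex hull `Q^e(𝒰)`: the symmetric matrices `A` such that
`f A ≤ sup_{B ∈ 𝒰} f B` for every symmetric quasiconvex `f`. -/
def symQuasiconvexHull (𝒰 : Set Mat) : Set Mat :=
  {A | A.IsSymm ∧ ∀ f : Mat → ℝ, IsSymQuasiconvex f →
    ∀ c : ℝ, (∀ B ∈ 𝒰, f B ≤ c) → f A ≤ c}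

/-- The symmetric lamination hulls `L^{e,i}(𝒰)` of finite order. -/
def symLamination (𝒰 : Set Mat) : ℕ → Set Mat
  | 0 => 𝒰
  | i + 1 => {X | ∃ A ∈ symLamination 𝒰 i, ∃ B ∈ symLamination 𝒰 i, Compatible A B ∧
      ∃ t ∈ Icc (0 : ℝ) 1, X = t • A + (1 - t) • B}

/-- The symmetric lamination convex hull `L^e(𝒰)`. -/
def symLaminationHull (𝒰 : Set Mat) : Set Mat := ⋃ i : ℕ, symLamination 𝒰 i

/-- `𝒰` is a set of symmetric matrices lying in the affine plane
`Π_Q = {U symmetric | ⟨Q, U⟩ = δ}` with symmetric normal `Q`. -/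
structure IsCoplanarWith (Q : Mat) (δ : ℝ) (𝒰 : Set Mat) : Prop where
  normal_symm : Q.IsSymm
  wells_symm : ∀ U ∈ 𝒰, U.IsSymm
  mem_plane : ∀ U ∈ 𝒰, frobInner Q U = δ

/-- Wedge configurations of four wells: three of the wells, `U₁, U₂, U₃`, contain exactly one
incompatible pair `{U₂, U₃}`, and the remaining well `U₀` lies in the relative interior of their
convex hull and is rank-one compatible with `U₂` and with `U₃`. -/
def IsWedge (𝒰 : Set Mat) : Prop :=
  ∃ U₀ U₁ U₂ U₃ : Mat, 𝒰 = {U₀, U₁, U₂, U₃} ∧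
    Compatible U₁ U₂ ∧ Compatible U₁ U₃ ∧ ¬ Compatible U₂ U₃ ∧
    U₀ ∈ intrinsicInterior ℝ (convexHull ℝ ({U₁, U₂, U₃} : Set Mat)) ∧
    RankOneCompatible U₀ U₂ ∧ RankOneCompatible U₀ U₃

/-- Counter-clockwise rotation by `π / 2`. -/
def perp (v : Fin 2 → ℝ) : Fin 2 → ℝ := ![-v 1, v 0]

/-- The rank-one matrix `v^⊥ ⊗ v^⊥`. -/
def perpTensor (v : Fin 2 → ℝ) : Mat := Matrix.vecMulVec (perp v) (perp v)

/-- `a, n` are linearly independent unit vectors such that `a^⊥ ⊗ a^⊥` and `n^⊥ ⊗ n^⊥` are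
orthogonal to `Q`: the two rank-one directions of the plane `Π_Q`. -/
structure AreRankOneDirections (Q : Mat) (a n : Fin 2 → ℝ) : Prop where
  unit_a : a ⬝ᵥ a = 1
  unit_n : n ⬝ᵥ n = 1
  linearIndependent : LinearIndependent ℝ ![a, n]
  orthogonal_a : frobInner Q (perpTensor a) = 0
  orthogonal_n : frobInner Q (perpTensor n) = 0

/-- The upper part of the planar compatible cone of `U`. -/
def upperCone (a n : Fin 2 → ℝ) (U : Mat) : Set Mat :=
  {V | ∃ ξ η : ℝ, 0 ≤ ξ ∧ η ≤ 0 ∧ V = U + ξ • perpTensor a + η • perpTensor n}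

/-- The lower part of the planar compatible cone of `U`. -/
def lowerCone (a n : Fin 2 → ℝ) (U : Mat) : Set Mat :=
  {V | ∃ ξ η : ℝ, ξ ≤ 0 ∧ 0 ≤ η ∧ V = U + ξ • perpTensor a + η • perpTensor n}

/-- The union `D` of the two segments `C({W₁, W₂})` and `C({V₁, V₂})`. -/
def twoSegments (V₁ V₂ W₁ W₂ : Mat) : Set Mat :=
  convexHull ℝ {W₁, W₂} ∪ convexHull ℝ {V₁, V₂}

/-- The standing assumptions: four wells in a plane whose normal has negative determinant, each
compatible with another one, not in a wedge configuration, with two different pairs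
`{V₁, V₂}`, `{W₁, W₂}` of rank-one compatible wells. -/
structure FourWells (Q : Mat) (δ : ℝ) (𝒰 : Set Mat) (V₁ V₂ W₁ W₂ : Mat) : Prop where
  card_eq : 𝒰.ncard = 4
  coplanar : IsCoplanarWith Q δ 𝒰
  det_neg : Q.det < 0
  exists_compatible : ∀ U ∈ 𝒰, ∃ V ∈ 𝒰, V ≠ U ∧ Compatible U V
  not_wedge : ¬ IsWedge 𝒰
  V_subset : {V₁, V₂} ⊆ 𝒰
  W_subset : {W₁, W₂} ⊆ 𝒰
  V_ne : V₁ ≠ V₂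
  W_ne : W₁ ≠ W₂
  pairs_ne : ({V₁, V₂} : Set Mat) ≠ {W₁, W₂}
  V_rankOne : RankOneCompatible V₁ V₂
  W_rankOne : RankOneCompatible W₁ W₂

/-- First alternative: `D` is disconnected. -/
def DisconnectedCase (V₁ V₂ W₁ W₂ : Mat) : Prop :=
  ¬ IsConnected (twoSegments V₁ V₂ W₁ W₂)

/-- Second alternative: `D` is connected and contains all the wells. -/
def ConnectedCase (𝒰 : Set Mat) (V₁ V₂ W₁ W₂ : Mat) : Prop :=
  IsConnected (twoSegments V₁ V₂ W₁ W₂) ∧ 𝒰 ⊆ twoSegments V₁ V₂ W₁ W₂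

/-- Third alternative: the two pairs share exactly one well `V`, and `D` lies in the upper or in
the lower part of the planar compatible cone of `V`. (Interchanging `a` and `n` interchanges the
two parts, so the choice of `a` and `n` does not matter.) -/
def ConeCase (Q : Mat) (V₁ V₂ W₁ W₂ : Mat) : Prop :=
  ∃ V : Mat, ({V₁, V₂} : Set Mat) ∩ {W₁, W₂} = {V} ∧
    ∃ a n : Fin 2 → ℝ, AreRankOneDirections Q a n ∧
      (twoSegments V₁ V₂ W₁ W₂ ⊆ upperCone a n V ∨ twoSegments V₁ V₂ W₁ W₂ ⊆ lowerCone a n V)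

/-! In the plane of the wells, use coordinates along the two rank-one directions, the second one
with reversed sign. The determinant of a difference of two matrices becomes a negative multiple of
the product of the two coordinate differences (`det_planeMap_sub`). Compatible then means comparable
for the product order, rank-one compatible means lying on a common axis-parallel line, and the
problem concerns four points of ℝ².

The lamination hull lies in the quasiconvex hull because sublevel sets of quasiconvex functions are
closed under rank-one lamination (`IsQuasiconvex.le_of_rankOne`, by an explicit smooth laminate). If
A and B are compatible, some skew S makes A + S - B of rank at most one, and f ∘ e does not see S
(`IsSymQuasiconvex.le_of_compatible`).

Conversely, few test functions suffice: affine functions and translates of -det. The latter are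
symmetric quasiconvex because det is a null Lagrangian, while passing to symmetric parts adds only a
nonnegative square (`isSymQuasiconvex_detQuad`). In coordinates they are positive multiples of (x -
x₀)(y - y₀), up to constants. So every point of the quasiconvex hull satisfies `IsOuter`, and it
remains to show that the wells are `Determined`. This is elementary planar geometry: products
centred at well-chosen points cut the convex hull down to regions bounded by axis-parallel or
increasing chords, and such regions are filled by horizontal or vertical slices.

Two disjoint aligned pairs are always determined (`determined_pairs`). If the pairs share a well,
placed at the origin, the argument is `determined_shared`. The configuration to be ruled out there
has two perpendicular positive arms and the fourth well in the open third quadrant. The origin is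
then interior to the triangle of the other three wells (`zero_mem_interior_triangle'`), which is a
wedge. In the examples, strictness holds because one product separates the midpoint of two wells
from all the wells. -/

/-- A planar set is closed under lamination if it contains every segment joining two of its points
that are comparable for the product order. -/
def LamClosed (H : Set (ℝ × ℝ)) : Prop :=
  ∀ p ∈ H, ∀ q ∈ H, p ≤ q → segment ℝ p q ⊆ H

/-- The points of the convex hull of `S` that the functions `(x - x₀) * (y - y₀)` do not separate
from `S`. -/
structure IsOuter (S : Set (ℝ × ℝ)) (z : ℝ × ℝ) : Prop where
  mem_hull : z ∈ convexHull ℝ S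
  le : ∀ x₀ y₀ c : ℝ, (∀ s ∈ S, (s.1 - x₀) * (s.2 - y₀) ≤ c) → (z.1 - x₀) * (z.2 - y₀) ≤ c

/-- Every point in the outer hull of `S` lies in all sets closed under lamination
that contain `S`. -/
def Determined (S : Set (ℝ × ℝ)) : Prop :=
  ∀ H : Set (ℝ × ℝ), LamClosed H → S ⊆ H → ∀ z, IsOuter S z → z ∈ H

theorem halfPlane_of_mem_convexHull {S : Set (ℝ × ℝ)} {z : ℝ × ℝ} (hz : z ∈ convexHull ℝ S)
    (α β γ : ℝ) (h : ∀ s ∈ S, α * s.1 + β * s.2 ≤ γ) : α * z.1 + β * z.2 ≤ γ := by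
  have hc : Convex ℝ {w : ℝ × ℝ | α * w.1 + β * w.2 ≤ γ} := by
    intro p hp q hq s t hs ht hst
    simp only [mem_ofPred_eq, Prod.fst_add, Prod.smul_fst, Prod.snd_add, Prod.smul_snd,
      smul_eq_mul] at *
    have e : γ = s * γ + t * γ := by rw [← add_mul, hst, one_mul]
    rw [e]
    nlinarith [mul_le_mul_of_nonneg_left hp hs, mul_le_mul_of_nonneg_left hq ht]
  exact convexHull_min (fun s hs => h s hs) hc hz

theorem IsOuter.half {S : Set (ℝ × ℝ)} {z : ℝ × ℝ} (hz : IsOuter S z)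
    (α β γ : ℝ) (h : ∀ s ∈ S, α * s.1 + β * s.2 ≤ γ) : α * z.1 + β * z.2 ≤ γ :=
  halfPlane_of_mem_convexHull hz.mem_hull α β γ h

/-! ### Slices and chords in lamination-closed planar sets. -/

section Slices

variable {H : Set (ℝ × ℝ)}

theorem LamClosed.combo (hH : LamClosed H) {p q : ℝ × ℝ} (hp : p ∈ H) (hq : q ∈ H) (hpq : p ≤ q)
    {t : ℝ} (h0 : 0 ≤ t) (h1 : t ≤ 1) :
    (p.1 + t * (q.1 - p.1), p.2 + t * (q.2 - p.2)) ∈ H := by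
  refine hH p hp q hq hpq ⟨1 - t, t, by linarith, h0, by ring, ?_⟩
  ext
  · simp; ring
  · simp; ring

theorem LamClosed.chord (hH : LamClosed H) {a b c d y : ℝ} (hp : (a, b) ∈ H) (hq : (c, d) ∈ H)
    (hac : a ≤ c) (hbd : b < d) (hby : b ≤ y) (hyd : y ≤ d) :
    (a + (y - b) / (d - b) * (c - a), y) ∈ H := by
  have hd : 0 < d - b := by linarith
  have := hH.combo hp hq ⟨hac, hbd.le⟩ (t := (y - b) / (d - b)) (by apply div_nonneg <;> linarith)
    (by rw [div_le_one hd]; linarith)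
  convert this using 2
  simp only
  field_simp
  ring

theorem LamClosed.slice_h (hH : LamClosed H) {a c x y : ℝ} (hp : (a, y) ∈ H) (hq : (c, y) ∈ H)
    (h1 : a ≤ x) (h2 : x ≤ c) : (x, y) ∈ H := by
  rcases eq_or_lt_of_le (h1.trans h2) with h | h
  · obtain rfl : x = a := by linarith
    exact hp
  · have hd : 0 < c - a := by linarith
    have := hH.combo hp hq ⟨h.le, le_rfl⟩ (t := (x - a) / (c - a)) (by apply div_nonneg <;> linarith)
      (by rw [div_le_one hd]; linarith)
    convert this using 2
    · simp only
      field_simp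
      ring
    · simp

theorem LamClosed.swap (hH : LamClosed H) : LamClosed (Prod.swap ⁻¹' H) := by
  rintro p hp q hq hpq _ ⟨s, t, hs, ht, hst, rfl⟩
  refine hH p.swap hp q.swap hq ⟨hpq.2, hpq.1⟩ ⟨s, t, hs, ht, hst, ?_⟩
  ext <;> simp

theorem LamClosed.slice_v (hH : LamClosed H) {b d x y : ℝ} (hp : (x, b) ∈ H) (hq : (x, d) ∈ H)
    (h1 : b ≤ y) (h2 : y ≤ d) : (x, y) ∈ H :=
  hH.swap.slice_h (a := b) (c := d) (x := y) (y := x) hp hq h1 h2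

/-- A point lying horizontally between two increasing chords. -/
theorem LamClosed.between_h (hH : LamClosed H) {a b c d a' b' c' d' x y : ℝ}
    (h1 : (a, b) ∈ H) (h2 : (c, d) ∈ H) (hac : a ≤ c) (hbd : b < d) (hby : b ≤ y) (hyd : y ≤ d)
    (hl : (y - b) * (c - a) ≤ (x - a) * (d - b))
    (h1' : (a', b') ∈ H) (h2' : (c', d') ∈ H) (hac' : a' ≤ c') (hbd' : b' < d') (hby' : b' ≤ y)
    (hyd' : y ≤ d') (hr : (x - a') * (d' - b') ≤ (y - b') * (c' - a')) : (x, y) ∈ H := by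
  have hd : 0 < d - b := by linarith
  have hd' : 0 < d' - b' := by linarith
  refine hH.slice_h (hH.chord h1 h2 hac hbd hby hyd) (hH.chord h1' h2' hac' hbd' hby' hyd') ?_ ?_
  · have : (y - b) / (d - b) * (c - a) ≤ x - a := by
      rw [div_mul_eq_mul_div, div_le_iff₀ hd]; exact hl
    linarith
  · have : x - a' ≤ (y - b') / (d' - b') * (c' - a') := by
      rw [div_mul_eq_mul_div, le_div_iff₀ hd']; exact hr
    linarith

/-- A point lying vertically between two increasing chords. -/
theorem LamClosed.between_v (hH : LamClosed H) {a b c d a' b' c' d' x y : ℝ}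
    (h1 : (a, b) ∈ H) (h2 : (c, d) ∈ H) (hbd : b ≤ d) (hac : a < c) (hax : a ≤ x) (hxc : x ≤ c)
    (hl : (x - a) * (d - b) ≤ (y - b) * (c - a))
    (h1' : (a', b') ∈ H) (h2' : (c', d') ∈ H) (hbd' : b' ≤ d') (hac' : a' < c') (hax' : a' ≤ x)
    (hxc' : x ≤ c') (hr : (y - b') * (c' - a') ≤ (x - a') * (d' - b')) : (x, y) ∈ H :=
  hH.swap.between_h (a := b) (b := a) (c := d) (d := c) (a' := b') (b' := a') (c' := d') (d' := c')
    (x := y) (y := x) h1 h2 hbd hac hax hxc hl h1' h2' hbd' hac' hax' hxc' hr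

/-- A lower bound of `T` is a lower bound of its convex hull, since an upper orthant is convex.
Every segment in the cone from `p` over the hull therefore joins comparable points. -/
theorem LamClosed.hull_insert (hH : LamClosed H) {p : ℝ × ℝ} {T : Set (ℝ × ℝ)} (hT : T.Nonempty)
    (hp : p ∈ H) (hTH : convexHull ℝ T ⊆ H) (hle : ∀ q ∈ T, p ≤ q) :
    convexHull ℝ (insert p T) ⊆ H := by
  rw [convexHull_insert hT]
  intro w hw
  rw [mem_convexJoin] at hw
  obtain ⟨a, rfl, b, hb, hw⟩ := hw
  exact hH _ hp _ (hTH hb) (convexHull_min (fun q hq => hle q hq) (convex_Ici a) hb) hw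

theorem LamClosed.hull_four (hH : LamClosed H) {p q r s : ℝ × ℝ} (hp : p ∈ H) (hq : q ∈ H)
    (hr : r ∈ H) (hs : s ∈ H) (hpq : p ≤ q) (hqr : q ≤ r) (hrs : r ≤ s) :
    convexHull ℝ {p, q, r, s} ⊆ H := by
  refine hH.hull_insert (insert_nonempty _ _) hp (hH.hull_insert (insert_nonempty _ _) hq
    (hH.hull_insert (singleton_nonempty _) hr (by simpa using hs) ?_) ?_) ?_
  · rintro _ rfl; exact hrs
  · rintro _ (rfl | rfl)
    · exact hqr
    · exact hqr.trans hrs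
  · rintro _ (rfl | rfl | rfl)
    · exact hpq
    · exact hpq.trans hqr
    · exact (hpq.trans hqr).trans hrs

end Slices

/-! ### Affine symmetries of the planar problem. -/

section Symmetries

/-- An affine bijection transports the notion if its inverse preserves comparability, possibly with
the order reversed, and the family of products (x - x₀)(y - y₀) is pulled back into itself. Reversal
is allowed because segments are unoriented. -/
theorem Determined.of_image (e : (ℝ × ℝ) ≃ᵃ[ℝ] (ℝ × ℝ))
    (hmono : ∀ p q, e p ≤ e q → p ≤ q ∨ q ≤ p)
    (hform : ∀ x₀ y₀ : ℝ, ∃ x₁ y₁ : ℝ, ∀ p : ℝ × ℝ,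
      ((e p).1 - x₀) * ((e p).2 - y₀) = (p.1 - x₁) * (p.2 - y₁))
    {S : Set (ℝ × ℝ)} (h : Determined (e '' S)) : Determined S := by
  intro H hH hS z hz
  have hH' : LamClosed (e '' H) := by
    rintro _ ⟨p, hp, rfl⟩ _ ⟨q, hq, rfl⟩ hpq
    have : segment ℝ p q ⊆ H := by
      rcases hmono p q hpq with h | h
      · exact hH p hp q hq h
      · rw [segment_symm]; exact hH q hq p hp h
    have h2 := image_segment ℝ (e : (ℝ × ℝ) →ᵃ[ℝ] (ℝ × ℝ)) p q
    simp only [AffineEquiv.coe_toAffineMap] at h2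
    rw [← h2]
    exact image_mono this
  have hz' : IsOuter (e '' S) (e z) := by
    refine ⟨?_, ?_⟩
    · have h2 := AffineMap.image_convexHull (e : (ℝ × ℝ) →ᵃ[ℝ] (ℝ × ℝ)) S
      simp only [AffineEquiv.coe_toAffineMap] at h2
      rw [← h2]
      exact mem_image_of_mem _ hz.mem_hull
    · intro x₀ y₀ c hc
      obtain ⟨x₁, y₁, h1⟩ := hform x₀ y₀
      rw [h1]
      refine hz.le _ _ _ fun s hs => ?_
      rw [← h1]
      exact hc _ (mem_image_of_mem _ hs)
  obtain ⟨w, hw, hwz⟩ := h _ hH' (image_mono hS) _ hz'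
  rwa [← e.injective hwz]

theorem Determined.of_swap {S : Set (ℝ × ℝ)} (h : Determined (Prod.swap '' S)) : Determined S := by
  refine Determined.of_image (LinearEquiv.prodComm ℝ ℝ ℝ).toAffineEquiv ?_ ?_ h
  · rintro ⟨a, b⟩ ⟨c, d⟩ h
    exact Or.inl ⟨h.2, h.1⟩
  · intro x₀ y₀
    exact ⟨y₀, x₀, fun p => by simp; ring⟩

theorem Determined.of_neg {S : Set (ℝ × ℝ)} (h : Determined ((fun p => -p) '' S)) :
    Determined S := by
  refine Determined.of_image (LinearEquiv.neg ℝ).toAffineEquiv ?_ ?_ h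
  · intro p q h
    exact Or.inr (neg_le_neg_iff.1 h)
  · intro x₀ y₀
    exact ⟨-x₀, -y₀, fun p => by simp; ring⟩

theorem Determined.of_sub {S : Set (ℝ × ℝ)} (v : ℝ × ℝ) (h : Determined ((fun p => p - v) '' S)) :
    Determined S := by
  have e : (fun p : ℝ × ℝ => p - v) = AffineEquiv.constVAdd ℝ (ℝ × ℝ) (-v) := by
    funext p; simp [sub_eq_add_neg, add_comm]
  rw [e] at h
  refine Determined.of_image _ ?_ ?_ h
  · intro p q h
    left
    simpa using h
  · intro x₀ y₀
    exact ⟨x₀ + v.1, y₀ + v.2, fun p => by simp; ring⟩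

end Symmetries

/-! ### Two pairs on perpendicular lines. -/

section Perpendicular

/-- The part of the coordinate cross hull lying in the closed fourth quadrant. -/
theorem LamClosed.fourth_quadrant {H : Set (ℝ × ℝ)} (hH : LamClosed H) {a b x y : ℝ}
    (h0 : ((0 : ℝ), (0 : ℝ)) ∈ H) (ha : (a, (0 : ℝ)) ∈ H) (hb : ((0 : ℝ), -b) ∈ H) (ha0 : 0 ≤ a)
    (hb0 : 0 ≤ b) (hx : 0 ≤ x) (hy : y ≤ 0) (hxa : x ≤ a) (hyb : -b ≤ y)
    (hl : b * x - a * y ≤ a * b) : (x, y) ∈ H := by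
  rcases eq_or_lt_of_le hb0 with rfl | hb1
  · obtain rfl : y = 0 := by linarith
    exact hH.slice_h h0 ha hx hxa
  · exact hH.between_h hb h0 le_rfl (by linarith) hyb hy (by nlinarith) hb ha ha0 (by linarith)
      hyb hy (by nlinarith)

theorem perp_origin_aux {H : Set (ℝ × ℝ)} (hH : LamClosed H) {x₁ x₂ y₁ y₂ x y : ℝ}
    (hS : {(x₁, (0 : ℝ)), (x₂, 0), (0, y₁), (0, y₂)} ⊆ H)
    (h0 : ((0 : ℝ), (0 : ℝ)) ∈ H) (hx : x₁ ≤ x₂) (hy : y₁ ≤ y₂)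
    (hz : (x, y) ∈ convexHull ℝ {(x₁, (0 : ℝ)), (x₂, 0), (0, y₁), (0, y₂)})
    (hx0 : 0 ≤ x) (hy0 : y ≤ 0) : (x, y) ∈ H := by
  -- An arm of the cross that does not extend in the required direction is replaced by the origin,
  -- so that a single right triangle covers all cases.
  have ha : (max x₂ 0, (0 : ℝ)) ∈ H := by
    rcases max_choice x₂ 0 with h | h <;> rw [h]
    · exact hS (by simp)
    · exact h0
  have hb : ((0 : ℝ), -(-min y₁ 0)) ∈ H := by
    rw [neg_neg]
    rcases min_choice y₁ 0 with h | h <;> rw [h]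
    · exact hS (by simp)
    · exact h0
  have ha1 := le_max_left x₂ 0
  have ha2 := le_max_right x₂ 0
  have hb1 := min_le_left y₁ 0
  have hb2 := min_le_right y₁ 0
  generalize max x₂ 0 = a at *
  generalize min y₁ 0 = b at *
  have key := halfPlane_of_mem_convexHull hz
  refine hH.fourth_quadrant h0 ha hb ha2 (by linarith) hx0 hy0 ?_ ?_ ?_
  · have := key 1 0 a (by rintro s (rfl | rfl | rfl | rfl) <;> simp <;> linarith)
    simpa using this
  · have := key 0 (-1) (-b) (by rintro s (rfl | rfl | rfl | rfl) <;> simp <;> linarith)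
    simp at this
    linarith
  · have := key (-b) (-a) (a * (-b))
      (by rintro s (rfl | rfl | rfl | rfl) <;> simp only <;> nlinarith)
    simp only at this
    linarith

/-- The hull lies in the first quadrant, so a nonpositive product forces the point onto an axis.
There the line through (x₁, 0) and (0, y₁) keeps it away from the origin, hence inside one of the
two given segments. -/
theorem perp_positive {H : Set (ℝ × ℝ)} (hH : LamClosed H) {x₁ x₂ y₁ y₂ x y : ℝ}
    (hS : {(x₁, (0 : ℝ)), (x₂, 0), (0, y₁), (0, y₂)} ⊆ H)
    (hx : x₁ ≤ x₂) (hy : y₁ ≤ y₂) (hx1 : 0 < x₁) (hy1 : 0 < y₁)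
    (hz : (x, y) ∈ convexHull ℝ {(x₁, (0 : ℝ)), (x₂, 0), (0, y₁), (0, y₂)})
    (hxy : x * y ≤ 0) : (x, y) ∈ H := by
  have key := halfPlane_of_mem_convexHull hz
  have h1 := key (-1) 0 0 (by rintro s (rfl | rfl | rfl | rfl) <;> simp <;> linarith)
  have h2 := key 0 (-1) 0 (by rintro s (rfl | rfl | rfl | rfl) <;> simp <;> linarith)
  have h3 := key 1 0 x₂ (by rintro s (rfl | rfl | rfl | rfl) <;> simp <;> linarith)
  have h4 := key 0 1 y₂ (by rintro s (rfl | rfl | rfl | rfl) <;> simp <;> linarith)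
  have h5 := key (-y₁) (-x₁) (-(x₁ * y₁))
    (by rintro s (rfl | rfl | rfl | rfl) <;> simp only <;> nlinarith)
  simp only at h1 h2 h3 h4 h5
  have hxy0 : x * y = 0 := le_antisymm hxy (mul_nonneg (by linarith) (by linarith))
  rcases mul_eq_zero.1 hxy0 with rfl | rfl
  · exact hH.slice_v (b := y₁) (d := y₂) (hS (by simp)) (hS (by simp)) (by nlinarith) (by linarith)
  · exact hH.slice_h (a := x₁) (c := x₂) (hS (by simp)) (hS (by simp)) (by nlinarith) (by linarith)

theorem LamClosed.neg {H : Set (ℝ × ℝ)} (hH : LamClosed H) : LamClosed ((fun p => -p) ⁻¹' H) := by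
  rintro p hp q hq hpq _ ⟨s, t, hs, ht, hst, rfl⟩
  refine hH (-q) hq (-p) hp (neg_le_neg hpq) ⟨t, s, ht, hs, by linarith, ?_⟩
  simp only [smul_neg, neg_add_rev]

theorem neg_mem_hull {x₁ x₂ y₁ y₂ x y : ℝ}
    (hz : (x, y) ∈ convexHull ℝ {(x₁, (0 : ℝ)), (x₂, 0), (0, y₁), (0, y₂)}) :
    (-x, -y) ∈ convexHull ℝ {(-x₂, (0 : ℝ)), (-x₁, 0), (0, -y₂), (0, -y₁)} := by
  have h := LinearMap.image_convexHull (LinearEquiv.neg ℝ (M := ℝ × ℝ)).toLinearMap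
    {(x₁, (0 : ℝ)), (x₂, 0), (0, y₁), (0, y₂)}
  have h2 : (-x, -y) ∈ (LinearEquiv.neg ℝ (M := ℝ × ℝ)).toLinearMap ''
    convexHull ℝ {(x₁, (0 : ℝ)), (x₂, 0), (0, y₁), (0, y₂)} := ⟨(x, y), hz, by simp⟩
  rw [h] at h2
  refine convexHull_mono ?_ h2
  rintro _ ⟨s, (rfl | rfl | rfl | rfl), rfl⟩ <;> simp

/-- Two perpendicular axis-parallel pairs. -/
theorem determined_perp_origin {x₁ x₂ y₁ y₂ : ℝ} (hx : x₁ ≤ x₂) (hy : y₁ ≤ y₂) :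
    Determined {(x₁, (0 : ℝ)), (x₂, 0), (0, y₁), (0, y₂)} := by
  rintro H hH hS ⟨x, y⟩ hz
  -- The product centred at the crossing point of the two lines vanishes on all four wells.
  have hxy : x * y ≤ 0 := by
    have := hz.le 0 0 0 (by rintro s (rfl | rfl | rfl | rfl) <;> simp)
    simpa using this
  have hSn : {(-x₂, (0 : ℝ)), (-x₁, 0), (0, -y₂), (0, -y₁)} ⊆ (fun p : ℝ × ℝ => -p) ⁻¹' H := by
    rintro s (rfl | rfl | rfl | rfl) <;> exact hS (by simp)
  have hzn := neg_mem_hull hz.mem_hull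
  by_cases h0 : ((0 : ℝ), (0 : ℝ)) ∈ H
  · rcases le_total 0 x with h | h
    · rcases le_total y 0 with h' | h'
      · exact perp_origin_aux hH hS h0 hx hy hz.mem_hull h h'
      rcases eq_or_lt_of_le h' with rfl | h'
      · exact perp_origin_aux hH hS h0 hx hy hz.mem_hull h le_rfl
      obtain rfl : x = 0 := by nlinarith
      have := perp_origin_aux hH.neg hSn (by simpa using h0) (neg_le_neg hx) (neg_le_neg hy) hzn
        (by simp) (by linarith)
      simpa using this
    · rcases le_total 0 y with h' | h'
      · have := perp_origin_aux hH.neg hSn (by simpa using h0) (neg_le_neg hx) (neg_le_neg hy) hzn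
          (by linarith) (by linarith)
        simpa using this
      rcases eq_or_lt_of_le h with rfl | h
      · exact perp_origin_aux hH hS h0 hx hy hz.mem_hull le_rfl h'
      obtain rfl : y = 0 := by nlinarith
      have := perp_origin_aux hH.neg hSn (by simpa using h0) (neg_le_neg hx) (neg_le_neg hy) hzn
        (by linarith) (by simp)
      simpa using this
  · have hx' : 0 < x₁ ∨ x₂ < 0 := by
      by_contra! h
      exact h0 (hH.slice_h (a := x₁) (c := x₂) (hS (by simp)) (hS (by simp)) h.1 h.2)
    have hy' : 0 < y₁ ∨ y₂ < 0 := by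
      by_contra! h
      exact h0 (hH.slice_v (b := y₁) (d := y₂) (hS (by simp)) (hS (by simp)) h.1 h.2)
    rcases hx' with hx' | hx' <;> rcases hy' with hy' | hy'
    · exact perp_positive hH hS hx hy hx' hy' hz.mem_hull hxy
    · refine hH.hull_four (p := (0, y₁)) (q := (0, y₂)) (r := (x₁, 0)) (s := (x₂, 0))
        (hS (by simp)) (hS (by simp)) (hS (by simp)) (hS (by simp)) ⟨le_rfl, hy⟩ ⟨hx'.le, hy'.le⟩
        ⟨hx, le_rfl⟩ (convexHull_mono ?_ hz.mem_hull)
      rintro s (rfl | rfl | rfl | rfl) <;> simp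
    · refine hH.hull_four (p := (x₁, 0)) (q := (x₂, 0)) (r := (0, y₁)) (s := (0, y₂))
        (hS (by simp)) (hS (by simp)) (hS (by simp)) (hS (by simp)) ⟨hx, le_rfl⟩ ⟨hx'.le, hy'.le⟩
        ⟨le_rfl, hy⟩ hz.mem_hull
    · have := perp_positive hH.neg hSn (neg_le_neg hx) (neg_le_neg hy) (by linarith) (by linarith)
        hzn (by linarith)
      simpa using this

theorem determined_perp {x₁ x₂ y₁ y₂ k l : ℝ} (hx : x₁ ≤ x₂) (hy : y₁ ≤ y₂) :
    Determined {(x₁, k), (x₂, k), (l, y₁), (l, y₂)} := by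
  apply Determined.of_sub (l, k)
  have := determined_perp_origin (sub_le_sub_right hx l) (sub_le_sub_right hy k)
  convert this using 1
  simp [image_insert_eq]

end Perpendicular

/-! ### Two pairs on parallel lines. -/

section Parallel

/-- Two parallel horizontal pairs at different heights. -/
theorem determined_parallel_lt {x₁ x₂ u₁ u₂ k h : ℝ} (hx : x₁ ≤ x₂) (hu : u₁ ≤ u₂) (hkh : k < h) :
    Determined {(x₁, k), (x₂, k), (u₁, h), (u₂, h)} := by
  rintro H hH hS ⟨x, y⟩ hz
  have m1 : (x₁, k) ∈ H := hS (by simp)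
  have m2 : (x₂, k) ∈ H := hS (by simp)
  have m3 : (u₁, h) ∈ H := hS (by simp)
  have m4 : (u₂, h) ∈ H := hS (by simp)
  have hy1 := hz.half 0 (-1) (-k) (by rintro s (rfl | rfl | rfl | rfl) <;> simp <;> linarith)
  have hy2 := hz.half 0 1 h (by rintro s (rfl | rfl | rfl | rfl) <;> simp <;> linarith)
  have hl := hz.half (-(h - k)) (u₁ - x₁) ((u₁ - x₁) * k - x₁ * (h - k))
    (by rintro s (rfl | rfl | rfl | rfl) <;> simp only <;> nlinarith)
  have hr := hz.half (h - k) (-(u₂ - x₂)) (-(u₂ - x₂) * k + x₂ * (h - k))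
    (by rintro s (rfl | rfl | rfl | rfl) <;> simp only <;> nlinarith)
  -- Each of these products vanishes on one pair and is nonpositive on the other. Strictly between
  -- the two lines they say x ≤ u₂ and x₁ ≤ x.
  have q1 := hz.le u₂ k 0 (by rintro s (rfl | rfl | rfl | rfl) <;> simp only <;> nlinarith)
  have q2 := hz.le x₁ h 0 (by rintro s (rfl | rfl | rfl | rfl) <;> simp only <;> nlinarith)
  simp only at hy1 hy2 hl hr q1 q2
  have hy1' : k ≤ y := by linarith
  have hy2' : y ≤ h := by linarith
  rcases eq_or_lt_of_le hy1' with rfl | hy1'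
  · exact hH.slice_h m1 m2 (by nlinarith) (by nlinarith)
  rcases eq_or_lt_of_le hy2' with rfl | hy2'
  · exact hH.slice_h m3 m4 (by nlinarith) (by nlinarith)
  have b1 : x ≤ u₂ := by nlinarith
  have b2 : x₁ ≤ x := by nlinarith
  -- A left or right edge of the hull serves as a chord only if it is not decreasing. Otherwise a
  -- vertical one replaces it, so the left chord ends at c = max u₁ x₁ and the right chord starts at
  -- e = min x₂ u₂.
  obtain ⟨c, hc, hxc, hcH, hcl⟩ : ∃ c, c ≤ u₂ ∧ x₁ ≤ c ∧ (c, h) ∈ H ∧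
      (y - k) * (c - x₁) ≤ (x - x₁) * (h - k) := by
    rcases le_total x₁ u₁ with h1 | h1
    · exact ⟨u₁, hu, h1, m3, by nlinarith⟩
    · exact ⟨x₁, b2.trans b1, le_rfl, hH.slice_h m3 m4 h1 (b2.trans b1), by nlinarith⟩
  obtain ⟨e, he, heH, her⟩ : ∃ e, e ≤ u₂ ∧ (e, k) ∈ H ∧
      (x - e) * (h - k) ≤ (y - k) * (u₂ - e) := by
    rcases le_total x₂ u₂ with h1 | h1
    · exact ⟨x₂, h1, m2, by nlinarith⟩
    · exact ⟨u₂, le_rfl, hH.slice_h m1 m2 (b2.trans b1) h1, by nlinarith⟩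
  exact hH.between_h m1 hcH hxc hkh hy1'.le hy2'.le hcl heH m4 he hkh hy1'.le hy2'.le her

/-- Wells on a horizontal line. -/
theorem determined_line {S : Set (ℝ × ℝ)} {l m k : ℝ} (hl : (l, k) ∈ S) (hm : (m, k) ∈ S)
    (hS : ∀ s ∈ S, s.2 = k ∧ l ≤ s.1 ∧ s.1 ≤ m) : Determined S := by
  rintro H hH hSH ⟨x, y⟩ hz
  have h1 := hz.half 0 1 k (fun s hs => by linarith [(hS s hs).1])
  have h2 := hz.half 0 (-1) (-k) (fun s hs => by linarith [(hS s hs).1])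
  have h3 := hz.half 1 0 m (fun s hs => by linarith [(hS s hs).2.2])
  have h4 := hz.half (-1) 0 (-l) (fun s hs => by linarith [(hS s hs).2.1])
  simp only at h1 h2 h3 h4
  obtain rfl : y = k := by linarith
  exact hH.slice_h (hSH hl) (hSH hm) (by linarith) (by linarith)

theorem determined_parallel {x₁ x₂ u₁ u₂ k h : ℝ} (hx : x₁ ≤ x₂) (hu : u₁ ≤ u₂) :
    Determined {(x₁, k), (x₂, k), (u₁, h), (u₂, h)} := by
  rcases lt_trichotomy k h with hk | rfl | hk
  · exact determined_parallel_lt hx hu hk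
  · refine determined_line (l := min x₁ u₁) (m := max x₂ u₂) (k := k) ?_ ?_ ?_
    · rcases min_choice x₁ u₁ with h | h <;> simp [h]
    · rcases max_choice x₂ u₂ with h | h <;> simp [h]
    · rintro s (rfl | rfl | rfl | rfl) <;> simp [*]
  · have := determined_parallel_lt hu hx hk
    convert this using 1
    ext s
    simp only [mem_insert_iff, mem_singleton_iff]
    tauto

/-- Two points spanning a rank-one direction. -/
def Aligned (p q : ℝ × ℝ) : Prop := p.1 = q.1 ∨ p.2 = q.2

theorem determined_horizontal_pair {p q : ℝ × ℝ} {k x₁ x₂ : ℝ} (hx : x₁ ≤ x₂)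
    (h : Aligned p q) : Determined {(x₁, k), (x₂, k), p, q} := by
  obtain ⟨a, b⟩ := p
  obtain ⟨c, d⟩ := q
  rcases h with h | h
  · obtain rfl : a = c := h
    rcases le_total b d with hbd | hbd
    · exact determined_perp hx hbd
    · rw [pair_comm]; exact determined_perp hx hbd
  · obtain rfl : b = d := h
    rcases le_total a c with hac | hac
    · exact determined_parallel hx hac
    · rw [pair_comm]; exact determined_parallel hx hac

/-- Two aligned pairs without further assumptions. -/
theorem determined_pairs {p q r s : ℝ × ℝ} (h : Aligned p q) (h' : Aligned r s) :
    Determined {p, q, r, s} := by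
  have key : ∀ p q r s : ℝ × ℝ, p.2 = q.2 → Aligned r s → Determined {p, q, r, s} := by
    rintro ⟨a, b⟩ ⟨c, d⟩ r s h h'
    obtain rfl : b = d := h
    rcases le_total a c with hac | hac
    · exact determined_horizontal_pair hac h'
    · rw [insert_comm]; exact determined_horizontal_pair hac h'
  rcases h with h | h
  · apply Determined.of_swap
    rw [image_insert_eq, image_insert_eq, image_insert_eq, image_singleton]
    exact key _ _ _ _ h h'.symm
  · exact key _ _ _ _ h h'

end Parallel

/-! ### Two pairs with a common well. -/

section SharedWell

/-- Comparability for the product order. -/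
def Comparable (p q : ℝ × ℝ) : Prop := p ≤ q ∨ q ≤ p

/-- The product (x - z₁)y vanishes on every well, so points above the axis satisfy x ≤ z₁. What
remains of the triangle lies to the right of the increasing chord from (l, 0) to the apex, and is
bounded on the other side by the vertical through the apex or by the chord from (m, 0). -/
theorem determined_collinear_of_pos {S : Set (ℝ × ℝ)} {l m z₁ z₂ : ℝ} (hl : (l, 0) ∈ S)
    (hm : (m, 0) ∈ S) (hZ : (z₁, z₂) ∈ S)
    (hS : ∀ s ∈ S, s = (z₁, z₂) ∨ (s.2 = 0 ∧ l ≤ s.1 ∧ s.1 ≤ m)) (hz2 : 0 < z₂) (hlz : l ≤ z₁) :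
    Determined S := by
  rintro H hH hSH ⟨x, y⟩ hz
  have cases : ∀ P : ℝ × ℝ → Prop, P (z₁, z₂) → (∀ u, l ≤ u → u ≤ m → P (u, 0)) → ∀ s ∈ S, P s := by
    rintro P h1 h2 ⟨a, b⟩ hs
    rcases hS _ hs with h | ⟨h, h3, h4⟩
    · rw [h]; exact h1
    · obtain rfl : b = 0 := h
      exact h2 a h3 h4
  have h1 := hz.half 0 (-1) 0 (cases _ (by simp only; linarith) (by intros; simp))
  have h2 := hz.half 0 1 z₂ (cases _ (by simp) (by intros; simp; linarith))
  have h3 := hz.half (-z₂) (z₁ - l) (-(l * z₂))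
    (cases _ (by simp only; nlinarith) (by intros; simp only; nlinarith))
  have h4 := hz.le z₁ 0 0 (cases _ (by simp) (by intros; simp))
  simp only at h1 h2 h3 h4
  have mZ := hSH hZ
  have ml := hSH hl
  have mm := hSH hm
  rcases le_total z₁ m with hzm | hzm
  · have h5 := hz.half 1 0 m (cases _ (by simpa) (by intros; simpa))
    simp only at h5
    rcases eq_or_lt_of_le (show 0 ≤ y by linarith) with rfl | hy
    · exact hH.slice_h ml mm (by nlinarith) (by linarith)
    · exact hH.between_h ml mZ hlz hz2 hy.le (by linarith) (by linarith)
        (hH.slice_h ml mm hlz hzm) mZ le_rfl hz2 hy.le (by linarith) (by nlinarith)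
  · have h5 := hz.half z₂ (-(z₁ - m)) (m * z₂)
      (cases _ (by simp only; nlinarith) (by intros; simp only; nlinarith))
    simp only at h5
    exact hH.between_h ml mZ hlz hz2 (by linarith) (by linarith) (by linarith)
      mm mZ hzm hz2 (by linarith) (by linarith) (by linarith)

/-- All wells but one on the first coordinate axis. -/
theorem determined_collinear {S : Set (ℝ × ℝ)} {l m z₁ z₂ : ℝ} (hl : (l, 0) ∈ S)
    (hm : (m, 0) ∈ S) (hZ : (z₁, z₂) ∈ S)
    (hS : ∀ s ∈ S, s = (z₁, z₂) ∨ (s.2 = 0 ∧ l ≤ s.1 ∧ s.1 ≤ m))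
    (hc : ∃ s ∈ S, s ≠ (z₁, z₂) ∧ Comparable s (z₁, z₂)) : Determined S := by
  obtain ⟨⟨a, b⟩, hs, hne, hc⟩ := hc
  rcases hS _ hs with h | ⟨h, h3, h4⟩
  · exact absurd h hne
  obtain rfl : b = 0 := h
  simp only at h3 h4
  rcases lt_trichotomy z₂ 0 with hz | rfl | hz
  · apply Determined.of_neg
    refine determined_collinear_of_pos (l := -m) (m := -l) (z₁ := -z₁) (z₂ := -z₂) ⟨_, hm, by simp⟩
      ⟨_, hl, by simp⟩ ⟨_, hZ, by simp⟩ ?_ (by linarith) ?_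
    · rintro _ ⟨s, hs, rfl⟩
      rcases hS s hs with rfl | ⟨h1, h2, h3⟩
      · left; simp
      · right; simp; exact ⟨h1, h3, h2⟩
    · rcases hc with hc | hc
      · exact absurd hc.2 (by simpa using hz)
      · have : z₁ ≤ a := hc.1
        linarith
  · refine determined_line (l := min l z₁) (m := max m z₁) (k := 0) ?_ ?_ ?_
    · rcases min_choice l z₁ with h | h <;> rw [h] <;> assumption
    · rcases max_choice m z₁ with h | h <;> rw [h] <;> assumption
    · intro s hs
      rcases hS s hs with rfl | ⟨h1, h2, h3⟩
      · simp
      · exact ⟨h1, (min_le_left _ _).trans h2, h3.trans (le_max_left _ _)⟩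
  · refine determined_collinear_of_pos hl hm hZ hS hz ?_
    rcases hc with hc | hc
    · exact h3.trans hc.1
    · exact absurd hc.2 (by simpa using hz)

/-- Two perpendicular segments issuing from the origin in the positive directions, with a fourth
well in the closed first quadrant. -/
theorem determined_corner_first {r q z₁ z₂ : ℝ} (hr : 0 < r) (hq : 0 < q) (hz1 : 0 ≤ z₁)
    (hz2 : 0 ≤ z₂) : Determined {((0 : ℝ), (0 : ℝ)), (r, 0), (0, q), (z₁, z₂)} := by
  rintro H hH hS ⟨x, y⟩ hz
  have m0 : ((0 : ℝ), (0 : ℝ)) ∈ H := hS (by simp)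
  have mr : (r, (0 : ℝ)) ∈ H := hS (by simp)
  have mq : ((0 : ℝ), q) ∈ H := hS (by simp)
  have mz : (z₁, z₂) ∈ H := hS (by simp)
  have hx0 := hz.half (-1) 0 0 (by rintro s (rfl | rfl | rfl | rfl) <;> simp <;> linarith)
  have hy0 := hz.half 0 (-1) 0 (by rintro s (rfl | rfl | rfl | rfl) <;> simp <;> linarith)
  -- Off the axes these two products confine the point to the rectangle spanned by the origin and
  -- the fourth well.
  have q1 := hz.le z₁ 0 0 (by rintro s (rfl | rfl | rfl | rfl) <;> simp <;> positivity)
  have q2 := hz.le 0 z₂ 0 (by rintro s (rfl | rfl | rfl | rfl) <;> simp <;> positivity)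
  have hxr : z₁ ≤ r → x ≤ r := fun h => by
    simpa using hz.half 1 0 r (by rintro s (rfl | rfl | rfl | rfl) <;> simp <;> linarith)
  have hyq : z₂ ≤ q → y ≤ q := fun h => by
    simpa using hz.half 0 1 q (by rintro s (rfl | rfl | rfl | rfl) <;> simp <;> linarith)
  have hxr' : r ≤ z₁ → (x - r) * z₂ ≤ y * (z₁ - r) := fun h => by
    have := hz.half z₂ (-(z₁ - r)) (r * z₂)
      (by rintro s (rfl | rfl | rfl | rfl) <;> simp only <;> nlinarith)
    simp only at this
    linarith
  have hyq' : q ≤ z₂ → (y - q) * z₁ ≤ x * (z₂ - q) := fun h => by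
    have := hz.half (-(z₂ - q)) z₁ (q * z₁)
      (by rintro s (rfl | rfl | rfl | rfl) <;> simp only <;> nlinarith)
    simp only at this
    linarith
  -- This covers the degenerate case of a fourth well on the axis beyond r, where `q1` says nothing
  -- about points of the axis.
  have hxz : z₁ ≤ r ∨ 0 < z₂ ∨ x ≤ z₁ := by
    by_contra! h
    have := hz.half 1 0 z₁ (by rintro s (rfl | rfl | rfl | rfl) <;> simp <;> linarith)
    simp only at this
    linarith
  have hyz : z₂ ≤ q ∨ 0 < z₁ ∨ y ≤ z₂ := by
    by_contra! h
    have := hz.half 0 1 z₂ (by rintro s (rfl | rfl | rfl | rfl) <;> simp <;> linarith)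
    simp only at this
    linarith
  have hz20 : z₂ ≤ 0 → y ≤ q := fun h => hyq (by linarith)
  have hz10 : z₁ ≤ 0 → x ≤ r := fun h => hxr (by linarith)
  clear hS hz
  simp only at hx0 hy0 q1 q2
  replace hx0 : 0 ≤ x := by linarith
  replace hy0 : 0 ≤ y := by linarith
  rcases eq_or_lt_of_le hy0 with rfl | hy
  · by_cases h1 : x ≤ r
    · exact hH.slice_h m0 mr hx0 h1
    · push Not at h1
      have h2 : r < z₁ := by
        by_contra! h
        linarith [hxr h]
      have h3 : z₂ = 0 := by
        have := hxr' h2.le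
        nlinarith
      subst h3
      have h4 : x ≤ z₁ := by
        rcases hxz with h | h | h <;> linarith
      exact hH.slice_h m0 mz hx0 h4
  rcases eq_or_lt_of_le hx0 with rfl | hx
  · by_cases h1 : y ≤ q
    · exact hH.slice_v m0 mq hy0 h1
    · push Not at h1
      have h2 : q < z₂ := by
        by_contra! h
        linarith [hyq h]
      have h3 : z₁ = 0 := by
        have := hyq' h2.le
        nlinarith
      subst h3
      have h4 : y ≤ z₂ := by
        rcases hyz with h | h | h <;> linarith
      exact hH.slice_v m0 mz hy0 h4
  have hxz : x ≤ z₁ := by nlinarith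
  have hyz : y ≤ z₂ := by nlinarith
  have hz1 : 0 < z₁ := hx.trans_le hxz
  have hz2 : 0 < z₂ := hy.trans_le hyz
  -- The chord from the origin to the fourth well splits the region. Each half is bounded on its
  -- other side by a chord from the end of the corresponding arm, or by an axis-parallel one if the
  -- fourth well does not reach beyond that end.
  rcases le_total (z₁ * y) (z₂ * x) with hd | hd
  · rcases le_total z₁ r with h | h
    · exact hH.between_h m0 mz hz1.le hz2 hy.le hyz (by linarith)
        (hH.slice_h m0 mr hz1.le h) mz le_rfl hz2 hy.le hyz (by nlinarith)
    · exact hH.between_h m0 mz hz1.le hz2 hy.le hyz (by linarith)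
        mr mz h hz2 hy.le hyz (by linarith [hxr' h])
  · rcases le_total z₂ q with h | h
    · exact hH.between_v m0 mz hz2.le hz1 hx.le hxz (by linarith)
        (hH.slice_v m0 mq hz2.le h) mz le_rfl hz1 hx.le hxz (by nlinarith)
    · exact hH.between_v m0 mz hz2.le hz1 hx.le hxz (by linarith)
        mq mz h hz1 hx.le hxz (by linarith [hyq' h])

/-- Two perpendicular segments issuing from the origin in the positive directions, with a fourth
well in the second quadrant comparable to the upper end point. -/
theorem determined_corner_second {r q z₁ z₂ : ℝ} (hr : 0 < r) (hq : 0 < q) (hz1 : z₁ < 0)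
    (hz2 : 0 ≤ z₂) (hzq : z₂ ≤ q) :
    Determined {((0 : ℝ), (0 : ℝ)), (r, 0), (0, q), (z₁, z₂)} := by
  rintro H hH hS ⟨x, y⟩ hz
  have m0 : ((0 : ℝ), (0 : ℝ)) ∈ H := hS (by simp)
  have mr : (r, (0 : ℝ)) ∈ H := hS (by simp)
  have mq : ((0 : ℝ), q) ∈ H := hS (by simp)
  have mz : (z₁, z₂) ∈ H := hS (by simp)
  have hxl := hz.half (-1) 0 (-z₁) (by rintro s (rfl | rfl | rfl | rfl) <;> simp <;> linarith)
  have hxr := hz.half 1 0 r (by rintro s (rfl | rfl | rfl | rfl) <;> simp <;> linarith)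
  have hy0 := hz.half 0 (-1) 0 (by rintro s (rfl | rfl | rfl | rfl) <;> simp <;> linarith)
  have hyq := hz.half 0 1 q (by rintro s (rfl | rfl | rfl | rfl) <;> simp <;> linarith)
  have hln := hz.half (-(q - z₂)) (-z₁) (q * (-z₁))
    (by rintro s (rfl | rfl | rfl | rfl) <;> simp only <;> nlinarith)
  -- On the right the first product leaves only the axis; on the left the second one gives y ≥ z₂.
  have q1 := hz.le 0 0 0 (by rintro s (rfl | rfl | rfl | rfl) <;> simp only <;> nlinarith)
  have q2 := hz.le 0 z₂ 0 (by rintro s (rfl | rfl | rfl | rfl) <;> simp only <;> nlinarith)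
  simp only at hxl hxr hy0 hyq hln q1 q2
  rcases lt_trichotomy x 0 with hx | rfl | hx
  · exact hH.between_v mz (hH.slice_v m0 mq hz2 hzq) le_rfl hz1 (by linarith) hx.le (by nlinarith)
      mz mq hzq hz1 (by linarith) hx.le (by linarith)
  · exact hH.slice_v m0 mq (by linarith) (by linarith)
  · obtain rfl : y = 0 := by nlinarith
    exact hH.slice_h m0 mr hx.le (by linarith)

/-- Two perpendicular segments issuing from the origin in the positive directions, with a fourth
well outside the open third quadrant. -/
theorem determined_corner {r q z₁ z₂ : ℝ} (hr : 0 < r) (hq : 0 < q) (hz : ¬ (z₁ < 0 ∧ z₂ < 0))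
    (hc : Comparable (z₁, z₂) (0, 0) ∨ Comparable (z₁, z₂) (r, 0) ∨ Comparable (z₁, z₂) (0, q)) :
    Determined {((0 : ℝ), (0 : ℝ)), (r, 0), (0, q), (z₁, z₂)} := by
  simp only [Comparable, Prod.mk_le_mk] at hc
  rcases lt_or_ge z₁ 0 with h1 | h1
  · have h2 : 0 ≤ z₂ := by by_contra! h; exact hz ⟨h1, h⟩
    exact determined_corner_second hr hq h1 h2 (by grind)
  rcases lt_or_ge z₂ 0 with h2 | h2
  · apply Determined.of_swap
    have := determined_corner_second hq hr h2 h1 (by grind)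
    convert this using 1
    simp only [image_insert_eq, image_singleton, Prod.swap_prod_mk]
    rw [insert_comm (0, r)]
  · exact determined_corner_first hr hq h1 h2

/-- Three wells, pairwise comparable, whose convex hull contains the fourth one. -/
theorem determined_of_chain {p q r z : ℝ × ℝ} (hpq : p ≤ q) (hqr : q ≤ r)
    (hz : z ∈ convexHull ℝ {p, q, r}) : Determined {p, q, r, z} := by
  intro H hH hS w hw
  refine hH.hull_four (p := p) (q := q) (r := r) (s := r) (hS (by simp)) (hS (by simp))
    (hS (by simp)) (hS (by simp)) hpq hqr le_rfl ?_
  simp only [pair_eq_singleton]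
  refine convexHull_min ?_ (convex_convexHull ℝ _) hw.mem_hull
  rintro s (rfl | rfl | rfl | rfl)
  · exact subset_convexHull _ _ (by simp)
  · exact subset_convexHull _ _ (by simp)
  · exact subset_convexHull _ _ (by simp)
  · exact hz

theorem Comparable.symm {p q : ℝ × ℝ} (h : Comparable p q) : Comparable q p := Or.symm h

theorem Comparable.neg {p q : ℝ × ℝ} (h : Comparable p q) : Comparable (-p) (-q) := by
  rcases h with h | h
  · exact Or.inr (neg_le_neg h)
  · exact Or.inl (neg_le_neg h)

theorem Comparable.swap {p q : ℝ × ℝ} (h : Comparable p q) : Comparable p.swap q.swap := by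
  rcases h with h | h
  · exact Or.inl ⟨h.2, h.1⟩
  · exact Or.inr ⟨h.2, h.1⟩

theorem exists_of_mem_segment_zero {A Z : ℝ × ℝ} (h : Z ∈ segment ℝ 0 A) :
    ∃ t : ℝ, 0 ≤ t ∧ t ≤ 1 ∧ Z = (t * A.1, t * A.2) := by
  rw [segment_eq_image] at h
  obtain ⟨t, ht, rfl⟩ := h
  exact ⟨t, ht.1, ht.2, by ext <;> simp⟩

theorem mem_hull_of_mem_segments {A B Z : ℝ × ℝ} (h : Z ∈ segment ℝ 0 A ∪ segment ℝ 0 B)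
    {T : Set (ℝ × ℝ)} (h0 : (0 : ℝ × ℝ) ∈ T) (hA : A ∈ T) (hB : B ∈ T) : Z ∈ convexHull ℝ T := by
  rcases h with h | h
  · exact segment_subset_convexHull h0 hA h
  · exact segment_subset_convexHull h0 hB h

theorem determined_corner_pos {r q : ℝ} {Z : ℝ × ℝ} (hr : 0 < r) (hq : 0 < q)
    (hc : Comparable 0 Z ∨ Comparable (r, 0) Z ∨ Comparable (0, q) Z)
    (h : Z ∈ segment ℝ 0 (r, (0 : ℝ)) ∪ segment ℝ 0 ((0 : ℝ), q) ∨ ¬ (Z.1 < 0 ∧ Z.2 < 0)) :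
    Determined {0, (r, 0), (0, q), Z} := by
  refine determined_corner hr hq ?_ (hc.imp Comparable.symm (Or.imp Comparable.symm Comparable.symm))
  rcases h with (h | h) | h
  · obtain ⟨t, h0, h1, rfl⟩ := exists_of_mem_segment_zero h
    simp
  · obtain ⟨t, h0, h1, rfl⟩ := exists_of_mem_segment_zero h
    simp
  · exact h

/-- Arms of opposite signs make the three axis wells a chain through the origin, and a fourth well
on the arms lies in their hull. Arms of equal sign reduce to positive ones by reflection in the
origin. -/
theorem determined_corner_general {r q : ℝ} {Z : ℝ × ℝ} (hr : r ≠ 0) (hq : q ≠ 0)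
    (hc : Comparable 0 Z ∨ Comparable (r, 0) Z ∨ Comparable (0, q) Z)
    (h : Z ∈ segment ℝ 0 (r, (0 : ℝ)) ∪ segment ℝ 0 ((0 : ℝ), q) ∨
      (0 ≤ r ∧ 0 ≤ q ∧ ¬ (Z.1 < 0 ∧ Z.2 < 0))) :
    Determined {0, (r, 0), (0, q), Z} := by
  rcases h with h | ⟨h1, h2, h⟩
  · rcases lt_or_gt_of_ne hr with hr | hr <;> rcases lt_or_gt_of_ne hq with hq | hq
    · apply Determined.of_neg
      have := determined_corner_pos (r := -r) (q := -q) (Z := -Z) (by linarith) (by linarith) ?_ ?_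
      · convert this using 1
        simp [image_insert_eq]
      · refine hc.imp (fun h => ?_) (Or.imp (fun h => ?_) (fun h => ?_)) <;> simpa using h.neg
      · left
        rcases h with h | h
        · obtain ⟨t, h0, h1, rfl⟩ := exists_of_mem_segment_zero h
          left
          rw [segment_eq_image]
          exact ⟨t, ⟨h0, h1⟩, by ext <;> simp⟩
        · obtain ⟨t, h0, h1, rfl⟩ := exists_of_mem_segment_zero h
          right
          rw [segment_eq_image]
          exact ⟨t, ⟨h0, h1⟩, by ext <;> simp⟩
    · have := determined_of_chain (p := (r, 0)) (q := 0) (r := (0, q)) (z := Z) ⟨hr.le, le_rfl⟩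
        ⟨le_rfl, hq.le⟩ (mem_hull_of_mem_segments h (by simp) (by simp) (by simp))
      rwa [insert_comm]
    · have := determined_of_chain (p := (0, q)) (q := 0) (r := (r, 0)) (z := Z) ⟨le_rfl, hq.le⟩
        ⟨hr.le, le_rfl⟩ (mem_hull_of_mem_segments h (by simp) (by simp) (by simp))
      convert this using 1
      ext s
      simp only [mem_insert_iff, mem_singleton_iff]
      tauto
    · exact determined_corner_pos hr hq hc (Or.inl h)
  · exact determined_corner_pos (lt_of_le_of_ne h1 hr.symm) (lt_of_le_of_ne h2 hq.symm) hc
      (Or.inr h)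

theorem determined_collinear_general {r q : ℝ} {Z : ℝ × ℝ} (hZ0 : Z ≠ 0) (hZr : Z ≠ (r, 0))
    (hZq : Z ≠ (q, 0)) (hc : Comparable 0 Z ∨ Comparable (r, 0) Z ∨ Comparable (q, 0) Z) :
    Determined {0, (r, 0), (q, 0), Z} := by
  obtain ⟨a, b⟩ := Z
  refine determined_collinear (l := min 0 (min r q)) (m := max 0 (max r q)) (z₁ := a) (z₂ := b)
    ?_ ?_ (by simp) ?_ ?_
  · rcases min_choice 0 (min r q) with h | h <;> rw [h]
    · exact Or.inl rfl
    · rcases min_choice r q with h | h <;> rw [h] <;> simp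
  · rcases max_choice 0 (max r q) with h | h <;> rw [h]
    · exact Or.inl rfl
    · rcases max_choice r q with h | h <;> rw [h] <;> simp
  · rintro s (rfl | rfl | rfl | rfl) <;> simp
  · rcases hc with h | h | h
    · exact ⟨_, by simp, hZ0.symm, h⟩
    · exact ⟨_, by simp, hZr.symm, h⟩
    · exact ⟨_, by simp, hZq.symm, h⟩

/-- Two aligned pairs sharing the origin. -/
theorem determined_shared {A B Z : ℝ × ℝ} (hA : Aligned 0 A) (hB : Aligned 0 B) (hA0 : A ≠ 0)
    (hB0 : B ≠ 0) (hZ0 : Z ≠ 0) (hZA : Z ≠ A) (hZB : Z ≠ B)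
    (hc : Comparable 0 Z ∨ Comparable A Z ∨ Comparable B Z)
    (h : Z ∈ segment ℝ 0 A ∪ segment ℝ 0 B ∨
      (0 ≤ A ∧ 0 ≤ B ∧ (Z.1 < 0 → Z.2 < 0 → Comparable A B))) :
    Determined {0, A, B, Z} := by
  have corner : ∀ {r q : ℝ}, (r, (0 : ℝ)) ≠ 0 → ((0 : ℝ), q) ≠ 0 →
      Comparable 0 Z ∨ Comparable (r, 0) Z ∨ Comparable (0, q) Z →
      (Z ∈ segment ℝ 0 (r, (0 : ℝ)) ∪ segment ℝ 0 ((0 : ℝ), q) ∨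
        ((0 : ℝ × ℝ) ≤ (r, (0 : ℝ)) ∧ (0 : ℝ × ℝ) ≤ ((0 : ℝ), q) ∧
          (Z.1 < 0 → Z.2 < 0 → Comparable (r, 0) (0, q)))) →
      Determined {0, (r, 0), (0, q), Z} := by
    intro r q hr hq hc h
    have hr' : r ≠ 0 := fun h => hr (by simp [h])
    have hq' : q ≠ 0 := fun h => hq (by simp [h])
    refine determined_corner_general hr' hq' hc (h.imp id fun ⟨h1, h2, h3⟩ => ⟨h1.1, h2.2, ?_⟩)
    -- Nonzero perpendicular arms in the positive directions are incomparable, so the fourth well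
    -- cannot be in the open third quadrant.
    rintro ⟨h4, h5⟩
    rcases h3 h4 h5 with h6 | h6
    · exact hr' (le_antisymm h6.1 h1.1)
    · exact hq' (le_antisymm h6.2 h2.2)
  obtain ⟨a, a'⟩ := A
  obtain ⟨b, b'⟩ := B
  rcases hA with hA | hA <;> rcases hB with hB | hB
  · obtain rfl : a = 0 := hA.symm
    obtain rfl : b = 0 := hB.symm
    apply Determined.of_swap
    simp only [image_insert_eq, image_singleton, Prod.swap_prod_mk, Prod.swap_zero]
    refine determined_collinear_general (fun h => hZ0 ?_) (fun h => hZA ?_) (fun h => hZB ?_) ?_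
    · rw [← Z.swap_swap, h]; rfl
    · rw [← Z.swap_swap, h]; rfl
    · rw [← Z.swap_swap, h]; rfl
    · exact hc.imp Comparable.swap (Or.imp Comparable.swap Comparable.swap)
  · obtain rfl : a = 0 := hA.symm
    obtain rfl : b' = 0 := hB.symm
    rw [insert_comm (0, a')]
    refine corner hB0 hA0 (hc.imp id Or.symm) (h.imp (fun h => ?_)
      fun ⟨h1, h2, h3⟩ => ⟨h2, h1, fun h4 h5 => (h3 h4 h5).symm⟩)
    rwa [union_comm]
  · obtain rfl : a' = 0 := hA.symm
    obtain rfl : b = 0 := hB.symm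
    exact corner hA0 hB0 hc h
  · obtain rfl : a' = 0 := hA.symm
    obtain rfl : b' = 0 := hB.symm
    exact determined_collinear_general hZ0 hZA hZB hc

end SharedWell

/-! ### Null Lagrangians of compactly supported fields. -/

section Gradients

variable {φ : (Fin 2 → ℝ) → (Fin 2 → ℝ)}

theorem gradMat_apply (hφ : ContDiff ℝ ∞ φ) (x : Fin 2 → ℝ) (i j : Fin 2) :
    gradMat φ x i j = fderiv ℝ (fun y => φ y i) x (Pi.single j 1) := by
  have h : DifferentiableAt ℝ φ x := (hφ.differentiable (by simp)).differentiableAt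
  rw [fderiv_apply h i]
  rfl

theorem contDiff_component (hφ : ContDiff ℝ ∞ φ) (i : Fin 2) : ContDiff ℝ ∞ fun y => φ y i :=
  contDiff_pi.1 hφ i

theorem hasCompactSupport_component (hc : HasCompactSupport φ) (i : Fin 2) :
    HasCompactSupport fun y => φ y i :=
  hc.comp_left (g := fun v : Fin 2 → ℝ => v i) rfl

theorem contDiff_gradMat_apply (hφ : ContDiff ℝ ∞ φ) (i j : Fin 2) :
    ContDiff ℝ ∞ fun x => gradMat φ x i j := by
  simp only [gradMat_apply hφ]
  exact ((contDiff_component hφ i).fderiv_right (m := ∞) (by simp)).clm_apply contDiff_const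

theorem gradMat_eq_zero {x : Fin 2 → ℝ} (hx : x ∉ tsupport φ) : gradMat φ x = 0 := by
  ext i j
  simp [gradMat, fderiv_of_notMem_tsupport ℝ hx]

theorem hasCompactSupport_gradMat_apply (hc : HasCompactSupport φ) (i j : Fin 2) :
    HasCompactSupport fun x => gradMat φ x i j :=
  HasCompactSupport.intro hc fun x hx => by rw [gradMat_eq_zero hx]; rfl

theorem continuous_gradMat (hφ : ContDiff ℝ ∞ φ) : Continuous (gradMat φ) :=
  continuous_matrix fun i j => (contDiff_gradMat_apply hφ i j).continuous

theorem integrable_gradMat_apply (hφ : ContDiff ℝ ∞ φ) (hc : HasCompactSupport φ) (i j : Fin 2) :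
    Integrable fun x => gradMat φ x i j :=
  (contDiff_gradMat_apply hφ i j).continuous.integrable_of_hasCompactSupport
    (hasCompactSupport_gradMat_apply hc i j)

theorem integral_fderiv_mul_eq_neg {u w : (Fin 2 → ℝ) → ℝ} (hu : ContDiff ℝ ∞ u)
    (hw : ContDiff ℝ ∞ w) (hcw : HasCompactSupport w) (v : Fin 2 → ℝ) :
    ∫ x, u x * fderiv ℝ w x v = -∫ x, fderiv ℝ u x v * w x := by
  have hu1 : Continuous fun x => fderiv ℝ u x v :=
    (hu.continuous_fderiv (by simp)).clm_apply continuous_const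
  have hw1 : Continuous fun x => fderiv ℝ w x v :=
    (hw.continuous_fderiv (by simp)).clm_apply continuous_const
  apply integral_mul_fderiv_eq_neg_fderiv_mul_of_integrable
  · exact (hu1.mul hw.continuous).integrable_of_hasCompactSupport hcw.mul_left
  · exact (hu.continuous.mul hw1).integrable_of_hasCompactSupport (hcw.fderiv_apply ℝ v).mul_left
  · exact (hu.continuous.mul hw.continuous).integrable_of_hasCompactSupport hcw.mul_left
  · exact fun x _ => (hu.differentiable (by simp)).differentiableAt
  · exact fun x _ => (hw.differentiable (by simp)).differentiableAt

theorem integral_gradMat_apply (hφ : ContDiff ℝ ∞ φ) (hc : HasCompactSupport φ) (i j : Fin 2) :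
    ∫ x, gradMat φ x i j = 0 := by
  have := integral_fderiv_mul_eq_neg (u := fun _ => 1) contDiff_const (contDiff_component hφ i)
    (hasCompactSupport_component hc i) (Pi.single j 1)
  simpa [gradMat_apply hφ] using this

/-- Integrating by parts moves the derivatives off the first component. The two terms of the
determinant then differ only in the order of differentiation of the second component, and cancel by
symmetry of second derivatives. -/
theorem integral_det_gradMat (hφ : ContDiff ℝ ∞ φ) (hc : HasCompactSupport φ) :
    ∫ x, (gradMat φ x).det = 0 := by
  have hi : ∀ i j k l, Integrable fun x => gradMat φ x i j * gradMat φ x k l := fun i j k l =>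
    ((contDiff_gradMat_apply hφ i j).continuous.mul
      (contDiff_gradMat_apply hφ k l).continuous).integrable_of_hasCompactSupport
        (hasCompactSupport_gradMat_apply hc k l).mul_left
  have hu := contDiff_component hφ 0
  have hcu := hasCompactSupport_component hc 0
  have hw := contDiff_component hφ 1
  have parts : ∀ i j : Fin 2, ∫ x, gradMat φ x 1 i * gradMat φ x 0 j =
      -∫ x, fderiv ℝ (fderiv ℝ fun y => φ y 1) x (Pi.single j 1) (Pi.single i 1) * φ x 0 := by
    intro i j
    have h := integral_fderiv_mul_eq_neg (contDiff_gradMat_apply hφ 1 i) hu hcu (Pi.single j 1)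
    simp only [gradMat_apply hφ] at h ⊢
    rw [h]
    congr 2
    ext x
    congr 1
    have hd : DifferentiableAt ℝ (fderiv ℝ fun y => φ y 1) x :=
      ((hw.fderiv_right (m := ∞) (by simp)).differentiable (by simp)).differentiableAt
    rw [fderiv_clm_apply hd (differentiableAt_const _)]
    simp
  simp only [Matrix.det_fin_two]
  rw [integral_sub (hi _ _ _ _) (hi _ _ _ _)]
  simp only [fun x => mul_comm (gradMat φ x 0 0) (gradMat φ x 1 1),
    fun x => mul_comm (gradMat φ x 0 1) (gradMat φ x 1 0)]
  rw [parts, parts]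
  have hs : ∀ x, IsSymmSndFDerivAt ℝ (fun y => φ y 1) x := fun x =>
    hw.contDiffAt.isSymmSndFDerivAt (by
      rw [minSmoothness_of_isRCLikeNormedField]; exact WithTop.coe_le_coe.2 le_top)
  simp only [(hs _).eq (Pi.single 0 1) (Pi.single 1 1), sub_self]

end Gradients

/-! ### Quadratic symmetric quasiconvex test functions. -/

section Quadratic

/-- Quadratic functions whose quadratic part is a multiple of the determinant. -/
def detQuad (k α β γ : ℝ) (M : Mat) : ℝ := -k * M.det + (α * M 0 0 + β * M 1 1 + γ * M 0 1)

theorem continuous_detQuad (k α β γ : ℝ) : Continuous (detQuad k α β γ) := by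
  unfold detQuad
  fun_prop

theorem continuous_symPart : Continuous symPart := by
  unfold symPart
  fun_prop

theorem symPart_apply (M : Mat) (i j : Fin 2) : symPart M i j = (M i j + M j i) / 2 := by
  simp [symPart]; ring

theorem symPart_of_isSymm {M : Mat} (h : M.IsSymm) : symPart M = M := by
  ext i j
  rw [symPart_apply, h.apply]
  ring

/-- All terms but the last are linear in G or a multiple of det G, and have zero mean for a test
gradient. The final square comes from det e(G) = det G - (G₀₁ - G₁₀)² / 4; its sign is what makes k
≥ 0 sufficient. -/
theorem detQuad_symPart_add (k α β γ : ℝ) (M G : Mat) :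
    detQuad k α β γ (symPart (M + G)) = detQuad k α β γ (symPart M) +
      ((-k * symPart M 1 1 + α) * G 0 0 + (-k * symPart M 0 0 + β) * G 1 1 +
        (k * symPart M 0 1 + γ / 2) * G 0 1 + (k * symPart M 0 1 + γ / 2) * G 1 0 + -k * G.det +
        k / 4 * (G 0 1 - G 1 0) ^ 2) := by
  simp only [detQuad, symPart_apply, Matrix.det_fin_two, Matrix.add_apply]
  ring

theorem isSymQuasiconvex_detQuad {k : ℝ} (hk : 0 ≤ k) (α β γ : ℝ) :
    IsSymQuasiconvex (detQuad k α β γ) := by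
  have hcont : Continuous fun M => detQuad k α β γ (symPart M) :=
    (continuous_detQuad k α β γ).comp continuous_symPart
  refine ⟨?_, ?_, ?_⟩
  · let _ : MeasurableSpace Mat := borel Mat
    have : BorelSpace Mat := ⟨rfl⟩
    exact hcont.measurable
  · intro K hK
    obtain ⟨C, hC⟩ := hK.exists_bound_of_continuousOn hcont.continuousOn
    exact ⟨C, hC⟩
  · intro Ω hΩ hne hbd φ hφ hc hsupp M
    have hvol : 0 < volume.real Ω :=
      ENNReal.toReal_pos (hΩ.measure_pos volume hne).ne' hbd.measure_lt_top.ne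
    simp only [detQuad_symPart_add]
    set r : (Fin 2 → ℝ) → ℝ := fun x =>
      (-k * symPart M 1 1 + α) * gradMat φ x 0 0 + (-k * symPart M 0 0 + β) * gradMat φ x 1 1 +
        (k * symPart M 0 1 + γ / 2) * gradMat φ x 0 1 +
        (k * symPart M 0 1 + γ / 2) * gradMat φ x 1 0 + -k * (gradMat φ x).det +
        k / 4 * (gradMat φ x 0 1 - gradMat φ x 1 0) ^ 2 with hr
    have hr0 : ∀ x, x ∉ tsupport φ → r x = 0 := by
      intro x hx
      simp [hr, gradMat_eq_zero hx]
    have g := continuous_gradMat hφ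
    have hrc : Continuous r := by
      rw [hr]
      fun_prop
    have hri : Integrable r := hrc.integrable_of_hasCompactSupport (HasCompactSupport.intro hc hr0)
    have hdi : Integrable fun x => (gradMat φ x).det :=
      (Continuous.matrix_det g).integrable_of_hasCompactSupport
        (HasCompactSupport.intro hc fun x hx => by simp [gradMat_eq_zero hx])
    have hsi : Integrable fun x => (gradMat φ x 0 1 - gradMat φ x 1 0) ^ 2 :=
      Continuous.integrable_of_hasCompactSupport (by fun_prop)
        (HasCompactSupport.intro hc fun x hx => by simp [gradMat_eq_zero hx])
    have hint : 0 ≤ ∫ x in Ω, r x := by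
      rw [setIntegral_eq_integral_of_forall_compl_eq_zero
        (fun x hx => hr0 x fun h => hx (hsupp h))]
      have i := integrable_gradMat_apply hφ hc
      rw [hr, integral_add (by fun_prop) (by fun_prop), integral_add (by fun_prop) (by fun_prop),
        integral_add (by fun_prop) (by fun_prop), integral_add (by fun_prop) (by fun_prop),
        integral_add (by fun_prop) (by fun_prop)]
      simp only [integral_const_mul, integral_gradMat_apply hφ hc, integral_det_gradMat hφ hc,
        mul_zero, zero_add]
      have : 0 ≤ ∫ x, (gradMat φ x 0 1 - gradMat φ x 1 0) ^ 2 :=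
        integral_nonneg fun x => sq_nonneg _
      positivity
    have hfin : volume Ω ≠ ⊤ := hbd.measure_lt_top.ne
    rw [integral_add (integrableOn_const hfin (by simp)).integrable hri.integrableOn, setIntegral_const, smul_eq_mul,
      mul_add, inv_mul_cancel_left₀ hvol.ne']
    have : 0 ≤ (volume.real Ω)⁻¹ * ∫ x in Ω, r x := by positivity
    linarith

theorem detQuad_le_of_mem_hull {𝒰 : Set Mat} {A : Mat} (hA : A ∈ symQuasiconvexHull 𝒰) {k : ℝ}
    (hk : 0 ≤ k) (α β γ c : ℝ) (h : ∀ B ∈ 𝒰, detQuad k α β γ B ≤ c) : detQuad k α β γ A ≤ c :=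
  hA.2 _ (isSymQuasiconvex_detQuad hk α β γ) c h

end Quadratic

/-! ### Smooth one-dimensional profiles: ramp, tent and cutoff. -/

section Profiles

/-- A smooth ramp: it vanishes on `(-∞, 0]` and is the identity on `[δ, ∞)`. -/
noncomputable def smoothRamp (δ s : ℝ) : ℝ := s * Real.smoothTransition (s / δ)

theorem contDiff_smoothRamp (δ : ℝ) : ContDiff ℝ ∞ (smoothRamp δ) :=
  contDiff_id.mul (Real.smoothTransition.contDiff.comp (contDiff_id.div_const δ))

theorem smoothRamp_of_nonpos {δ s : ℝ} (hδ : 0 < δ) (hs : s ≤ 0) : smoothRamp δ s = 0 := by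
  rw [smoothRamp, Real.smoothTransition.zero_of_nonpos (div_nonpos_of_nonpos_of_nonneg hs hδ.le),
    mul_zero]

theorem smoothRamp_of_ge {δ s : ℝ} (hδ : 0 < δ) (hs : δ ≤ s) : smoothRamp δ s = s := by
  rw [smoothRamp, Real.smoothTransition.one_of_one_le ((one_le_div hδ).2 hs), mul_one]

theorem abs_smoothRamp_le (δ s : ℝ) : |smoothRamp δ s| ≤ |s| := by
  rw [smoothRamp, abs_mul, abs_of_nonneg (Real.smoothTransition.nonneg _)]
  exact mul_le_of_le_one_right (abs_nonneg s) (Real.smoothTransition.le_one _)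

theorem deriv_smoothRamp_of_neg {δ s : ℝ} (hδ : 0 < δ) (hs : s < 0) : deriv (smoothRamp δ) s = 0 := by
  have : smoothRamp δ =ᶠ[nhds s] fun _ => 0 :=
    Filter.mem_of_superset (Iio_mem_nhds hs) fun u hu => smoothRamp_of_nonpos hδ (le_of_lt hu)
  rw [this.deriv_eq, deriv_const]

theorem deriv_smoothRamp_of_gt {δ s : ℝ} (hδ : 0 < δ) (hs : δ < s) : deriv (smoothRamp δ) s = 1 := by
  have : smoothRamp δ =ᶠ[nhds s] fun u => u :=
    Filter.mem_of_superset (Ioi_mem_nhds hs) fun u hu => smoothRamp_of_ge hδ (le_of_lt hu)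
  rw [this.deriv_eq, deriv_id'']

/-- The ramps are rescalings of one another, `smoothRamp δ s = δ * smoothRamp 1 (s / δ)`. Hence
their slopes are bounded independently of δ. -/
theorem deriv_smoothRamp_scale {δ : ℝ} (hδ : 0 < δ) (s : ℝ) :
    deriv (smoothRamp δ) s = deriv (smoothRamp 1) (s / δ) := by
  have h : smoothRamp δ = fun s => δ * smoothRamp 1 (s / δ) := by
    ext u
    simp only [smoothRamp, div_one]
    field_simp
  have hd : HasDerivAt (smoothRamp 1) (deriv (smoothRamp 1) (s / δ)) (s / δ) :=
    ((contDiff_smoothRamp 1).differentiable (by simp) _).hasDerivAt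
  have := (hd.comp s ((hasDerivAt_id s).div_const δ)).const_mul δ
  rw [h]
  refine this.deriv.trans ?_
  field_simp

theorem exists_bound_deriv_smoothRamp :
    ∃ C : ℝ, 0 ≤ C ∧ ∀ δ, 0 < δ → ∀ s, |deriv (smoothRamp δ) s| ≤ C := by
  have hcont : Continuous (deriv (smoothRamp 1)) :=
    (contDiff_smoothRamp 1).continuous_deriv (by simp)
  obtain ⟨C, hC⟩ := (isCompact_Icc (a := (0 : ℝ)) (b := 1)).exists_bound_of_continuousOn
    hcont.continuousOn
  refine ⟨max C 1, by positivity, fun δ hδ s => ?_⟩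
  rw [deriv_smoothRamp_scale hδ]
  generalize s / δ = u
  rcases lt_or_ge u 0 with h | h
  · rw [deriv_smoothRamp_of_neg one_pos h]; simp
  rcases lt_or_ge 1 u with h' | h'
  · rw [deriv_smoothRamp_of_gt one_pos h']; simp
  · exact (hC u ⟨h, h'⟩).trans (le_max_left _ _)

/-- A compactly supported smooth function whose slope is `1 - t` or `-t` outside three short
intervals. -/
noncomputable def smoothTent (t δ s : ℝ) : ℝ :=
  (1 - t) * smoothRamp δ s - smoothRamp δ (s - t) + t * smoothRamp δ (s - 1)

theorem contDiff_smoothTent (t δ : ℝ) : ContDiff ℝ ∞ (smoothTent t δ) := by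
  have h := contDiff_smoothRamp δ
  have h1 : ∀ a : ℝ, ContDiff ℝ ∞ fun s => smoothRamp δ (s - a) := fun a =>
    h.comp (contDiff_id.sub contDiff_const)
  exact ((contDiff_const.mul h).sub (h1 t)).add (contDiff_const.mul (h1 1))

theorem deriv_smoothTent (t δ s : ℝ) : deriv (smoothTent t δ) s =
    (1 - t) * deriv (smoothRamp δ) s - deriv (smoothRamp δ) (s - t) +
      t * deriv (smoothRamp δ) (s - 1) := by
  have hd : ∀ u, HasDerivAt (smoothRamp δ) (deriv (smoothRamp δ) u) u := fun u =>
    ((contDiff_smoothRamp δ).differentiable (by simp) _).hasDerivAt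
  exact ((((hd s).const_mul (1 - t)).sub ((hd (s - t)).comp_sub_const s t)).add
    (((hd (s - 1)).comp_sub_const s 1).const_mul t)).deriv

/-- To the right of 1 + δ all three ramps equal their arguments, and (1 - t)s - (s - t) + t(s - 1) =
0. -/
theorem smoothTent_eq_zero {t δ s : ℝ} (hδ : 0 < δ) (ht : t ∈ Icc (0 : ℝ) 1)
    (hs : s ∉ Icc 0 (1 + δ)) : smoothTent t δ s = 0 := by
  obtain ⟨h0, h1⟩ := ht
  rw [smoothTent]
  rcases lt_or_ge s 0 with h | h
  · rw [smoothRamp_of_nonpos hδ h.le, smoothRamp_of_nonpos hδ (by linarith),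
      smoothRamp_of_nonpos hδ (by linarith)]
    ring
  · have h2 : 1 + δ < s := by
      by_contra! h3
      exact hs ⟨h, h3⟩
    rw [smoothRamp_of_ge hδ (by linarith), smoothRamp_of_ge hδ (by linarith),
      smoothRamp_of_ge hδ (by linarith)]
    ring

theorem abs_tent_combination_le {t a b c C : ℝ} (ht : t ∈ Icc (0 : ℝ) 1) (ha : |a| ≤ C)
    (hb : |b| ≤ C) (hc : |c| ≤ C) : |(1 - t) * a - b + t * c| ≤ 2 * C := by
  obtain ⟨h0, h1⟩ := ht
  rw [abs_le] at *
  constructor <;> nlinarith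

theorem abs_smoothTent_le {t δ : ℝ} (hδ : 0 < δ) (hδ1 : δ < 1) (ht : t ∈ Icc (0 : ℝ) 1) (s : ℝ) :
    |smoothTent t δ s| ≤ 4 := by
  by_cases hs : s ∈ Icc 0 (1 + δ)
  · have key : ∀ u ∈ Icc (0 : ℝ) 1, |smoothRamp δ (s - u)| ≤ 2 := fun u hu => by
      refine (abs_smoothRamp_le _ _).trans ?_
      rw [abs_le]
      constructor <;> linarith [hs.1, hs.2, hu.1, hu.2]
    have h0 := key 0 (by simp)
    rw [sub_zero] at h0
    have := abs_tent_combination_le ht h0 (key t ht) (key 1 (by simp))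
    rw [smoothTent]
    linarith
  · rw [smoothTent_eq_zero hδ ht hs]
    simp

theorem deriv_smoothTent_eq {t δ s : ℝ} (hδ : 0 < δ) (hs : δ < s) (hs1 : s < 1)
    (hst : s ∉ Icc t (t + δ)) :
    deriv (smoothTent t δ) s = 1 - t ∨ deriv (smoothTent t δ) s = -t := by
  rw [deriv_smoothTent, deriv_smoothRamp_of_gt hδ hs, deriv_smoothRamp_of_neg (s := s - 1) hδ (by linarith)]
  rcases lt_or_ge s t with h | h
  · left
    rw [deriv_smoothRamp_of_neg hδ (by linarith)]
    ring
  · right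
    have h2 : t + δ < s := by
      by_contra! h3
      exact hst ⟨h, h3⟩
    rw [deriv_smoothRamp_of_gt hδ (by linarith)]
    ring

/-- A smooth cutoff, equal to `1` on `[1, L - 1]` and to `0` outside `[0, L]`. -/
noncomputable def smoothCutoff (L y : ℝ) : ℝ :=
  Real.smoothTransition y * Real.smoothTransition (L - y)

theorem contDiff_smoothCutoff (L : ℝ) : ContDiff ℝ ∞ (smoothCutoff L) :=
  Real.smoothTransition.contDiff.mul
    (Real.smoothTransition.contDiff.comp (contDiff_const.sub contDiff_id))

theorem smoothCutoff_eq_zero {L y : ℝ} (hy : y ∉ Icc 0 L) : smoothCutoff L y = 0 := by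
  rw [smoothCutoff]
  rcases lt_or_ge y 0 with h | h
  · rw [Real.smoothTransition.zero_of_nonpos h.le, zero_mul]
  · have h2 : L < y := by
      by_contra! h3
      exact hy ⟨h, h3⟩
    rw [Real.smoothTransition.zero_of_nonpos (x := L - y) (by linarith), mul_zero]

theorem smoothCutoff_eq_one {L y : ℝ} (h1 : 1 ≤ y) (h2 : y ≤ L - 1) : smoothCutoff L y = 1 := by
  rw [smoothCutoff, Real.smoothTransition.one_of_one_le h1,
    Real.smoothTransition.one_of_one_le (by linarith), one_mul]

theorem deriv_smoothCutoff_eq_zero {L y : ℝ} (h1 : 1 < y) (h2 : y < L - 1) :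
    deriv (smoothCutoff L) y = 0 := by
  have : smoothCutoff L =ᶠ[nhds y] fun _ => 1 :=
    Filter.mem_of_superset (Ioo_mem_nhds h1 h2) fun u hu => smoothCutoff_eq_one hu.1.le hu.2.le
  rw [this.deriv_eq, deriv_const]

theorem abs_smoothCutoff_le (L y : ℝ) : |smoothCutoff L y| ≤ 1 := by
  rw [smoothCutoff, abs_of_nonneg
    (mul_nonneg (Real.smoothTransition.nonneg _) (Real.smoothTransition.nonneg _))]
  exact mul_le_one₀ (Real.smoothTransition.le_one _) (Real.smoothTransition.nonneg _)
    (Real.smoothTransition.le_one _)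

theorem exists_bound_deriv_smoothTransition :
    ∃ C : ℝ, 0 ≤ C ∧ ∀ s, |deriv Real.smoothTransition s| ≤ C := by
  have hcont : Continuous (deriv Real.smoothTransition) :=
    (Real.smoothTransition.contDiff (n := ⊤)).continuous_deriv (by simp)
  obtain ⟨C, hC⟩ := (isCompact_Icc (a := (0 : ℝ)) (b := 1)).exists_bound_of_continuousOn
    hcont.continuousOn
  refine ⟨max C 0, by positivity, fun s => ?_⟩
  rcases lt_or_ge s 0 with h | h
  · have : Real.smoothTransition =ᶠ[nhds s] fun _ => 0 :=
      Filter.mem_of_superset (Iio_mem_nhds h) fun u hu => Real.smoothTransition.zero_of_nonpos (le_of_lt hu)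
    rw [this.deriv_eq, deriv_const]; simp
  rcases lt_or_ge 1 s with h' | h'
  · have : Real.smoothTransition =ᶠ[nhds s] fun _ => 1 :=
      Filter.mem_of_superset (Ioi_mem_nhds h') fun u hu => Real.smoothTransition.one_of_one_le (le_of_lt hu)
    rw [this.deriv_eq, deriv_const]; simp
  · exact (hC s ⟨h, h'⟩).trans (le_max_left _ _)

theorem exists_bound_deriv_smoothCutoff :
    ∃ C : ℝ, 0 ≤ C ∧ ∀ L y, |deriv (smoothCutoff L) y| ≤ C := by
  obtain ⟨C, hC0, hC⟩ := exists_bound_deriv_smoothTransition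
  refine ⟨C + C, by positivity, fun L y => ?_⟩
  have hd : ∀ u, HasDerivAt Real.smoothTransition (deriv Real.smoothTransition u) u := fun u =>
    ((Real.smoothTransition.contDiff (n := ⊤)).differentiable (by simp) _).hasDerivAt
  have h := ((hd y).mul ((hd (L - y)).comp_const_sub L y)).deriv
  have h' : deriv (smoothCutoff L) y = _ := h
  rw [h']
  refine (abs_add_le _ _).trans (add_le_add ?_ ?_)
  · rw [abs_mul, abs_of_nonneg (Real.smoothTransition.nonneg (L - y))]
    exact (mul_le_of_le_one_right (abs_nonneg _) (Real.smoothTransition.le_one _)).trans (hC _)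
  · rw [abs_mul, abs_neg, abs_of_nonneg (Real.smoothTransition.nonneg y)]
    exact (mul_le_of_le_one_left (abs_nonneg _) (Real.smoothTransition.le_one _)).trans (hC _)

end Profiles

/-! ### The laminate test field and its gradient. -/

section Laminate

variable (e : (Fin 2 → ℝ) ≃L[ℝ] (Fin 2 → ℝ)) (p : Fin 2 → ℝ) (t δ L : ℝ)

/-- A test field whose gradient is a simple laminate on most of its support. -/
noncomputable def laminate (x : Fin 2 → ℝ) : Fin 2 → ℝ :=
  fun i => p i * (smoothTent t δ (e x 0) * smoothCutoff L (e x 1))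

theorem contDiff_laminate : ContDiff ℝ ∞ (laminate e p t δ L) := by
  have he : ∀ j, ContDiff ℝ ∞ fun x => e x j := fun j => contDiff_pi.1 e.contDiff j
  exact contDiff_pi.2 fun i => contDiff_const.mul
    (((contDiff_smoothTent t δ).comp (he 0)).mul ((contDiff_smoothCutoff L).comp (he 1)))

theorem gradMat_laminate (x : Fin 2 → ℝ) : gradMat (laminate e p t δ L) x =
    (deriv (smoothTent t δ) (e x 0) * smoothCutoff L (e x 1)) •
      Matrix.vecMulVec p (fun j => e (Pi.single j 1) 0) +
    (smoothTent t δ (e x 0) * deriv (smoothCutoff L) (e x 1)) •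
      Matrix.vecMulVec p (fun j => e (Pi.single j 1) 1) := by
  ext i j
  rw [gradMat_apply (contDiff_laminate e p t δ L)]
  have he : ∀ k : Fin 2, HasFDerivAt (fun x => e x k)
      ((ContinuousLinearMap.proj k).comp (e : (Fin 2 → ℝ) →L[ℝ] (Fin 2 → ℝ))) x := fun k =>
    hasFDerivAt_pi'.1 e.hasFDerivAt k
  have hg : HasDerivAt (smoothTent t δ) (deriv (smoothTent t δ) (e x 0)) (e x 0) :=
    ((contDiff_smoothTent t δ).differentiable (by simp) _).hasDerivAt
  have hη : HasDerivAt (smoothCutoff L) (deriv (smoothCutoff L) (e x 1)) (e x 1) :=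
    ((contDiff_smoothCutoff L).differentiable (by simp) _).hasDerivAt
  have h := (((hg.comp_hasFDerivAt x (he 0)).mul (hη.comp_hasFDerivAt x (he 1))).const_mul (p i))
  have h' : fderiv ℝ (fun y => laminate e p t δ L y i) x = _ := h.fderiv
  rw [h']
  simp [Matrix.vecMulVec_apply]
  ring

/-- Preimages of rectangles. -/
def slantedRect (α β γ ρ : ℝ) : Set (Fin 2 → ℝ) := e ⁻¹' Icc ![α, γ] ![β, ρ]

variable {e p t δ L}

theorem mem_slantedRect {α β γ ρ : ℝ} {x : Fin 2 → ℝ} :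
    x ∈ slantedRect e α β γ ρ ↔ (α ≤ e x 0 ∧ e x 0 ≤ β) ∧ γ ≤ e x 1 ∧ e x 1 ≤ ρ := by
  simp only [slantedRect, mem_preimage, mem_Icc, Pi.le_def, Fin.forall_fin_two, Matrix.cons_val_zero,
    Matrix.cons_val_one]
  tauto

theorem isCompact_slantedRect (α β γ ρ : ℝ) : IsCompact (slantedRect e α β γ ρ) :=
  e.toHomeomorph.isCompact_preimage.2 isCompact_Icc

theorem laminate_eq_zero (hδ : 0 < δ) (ht : t ∈ Icc (0 : ℝ) 1) {x : Fin 2 → ℝ}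
    (hx : x ∉ slantedRect e 0 (1 + δ) 0 L) : laminate e p t δ L x = 0 := by
  ext i
  rw [mem_slantedRect, not_and_or] at hx
  rcases hx with hx | hx
  · simp [laminate, smoothTent_eq_zero hδ ht hx]
  · simp [laminate, smoothCutoff_eq_zero hx]

theorem tsupport_laminate_subset (hδ : 0 < δ) (ht : t ∈ Icc (0 : ℝ) 1) :
    tsupport (laminate e p t δ L) ⊆ slantedRect e 0 (1 + δ) 0 L := by
  refine closure_minimal (fun x hx => ?_) (isCompact_slantedRect _ _ _ _).isClosed
  by_contra h
  exact hx (laminate_eq_zero hδ ht h)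

variable (e) in
theorem exists_measure_rect : ∃ κ : ℝ, 0 ≤ κ ∧
    (∀ α β γ ρ : ℝ, α ≤ β → γ ≤ ρ →
      volume.real (slantedRect e α β γ ρ) = κ * ((β - α) * (ρ - γ))) ∧
    (∀ α β γ ρ : ℝ, α ≤ β → γ ≤ ρ →
      volume.real (e ⁻¹' univ.pi fun i => Ioo (![α, γ] i) (![β, ρ] i)) =
        κ * ((β - α) * (ρ - γ))) := by
  refine ⟨|LinearMap.det ((e.symm : (Fin 2 → ℝ) →L[ℝ] (Fin 2 → ℝ)) :
    (Fin 2 → ℝ) →ₗ[ℝ] (Fin 2 → ℝ))|, abs_nonneg _, ?_, ?_⟩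
  · intro α β γ ρ h1 h2
    rw [slantedRect, Measure.real, Measure.addHaar_preimage_continuousLinearEquiv,
      ENNReal.toReal_mul, ENNReal.toReal_ofReal (abs_nonneg _), Real.volume_Icc_pi_toReal]
    · simp [Fin.prod_univ_two]
    · intro i
      fin_cases i <;> simpa
  · intro α β γ ρ h1 h2
    rw [Measure.real, Measure.addHaar_preimage_continuousLinearEquiv,
      ENNReal.toReal_mul, ENNReal.toReal_ofReal (abs_nonneg _), Real.volume_pi_Ioo_toReal]
    · simp [Fin.prod_univ_two]
    · intro i
      fin_cases i <;> simpa

end Laminate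

/-! ### Lamination inside sublevel sets of quasiconvex functions. -/

section RankOne

/-- Sublevel sets of quasiconvex functions are closed under simple laminates. -/
theorem IsQuasiconvex.le_of_rankOne {F : Mat → ℝ} (hF : IsQuasiconvex F)
    (e : (Fin 2 → ℝ) ≃L[ℝ] (Fin 2 → ℝ)) (p : Fin 2 → ℝ) {t c : ℝ} (ht : t ∈ Icc (0 : ℝ) 1) (M : Mat)
    (hA : F (M + (1 - t) • Matrix.vecMulVec p fun j => e (Pi.single j 1) 0) ≤ c)
    (hB : F (M + (-t) • Matrix.vecMulVec p fun j => e (Pi.single j 1) 0) ≤ c) : F M ≤ c := by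
  set P : Mat := Matrix.vecMulVec p fun j => e (Pi.single j 1) 0 with hP
  set P' : Mat := Matrix.vecMulVec p fun j => e (Pi.single j 1) 1 with hP'
  obtain ⟨C₁, hC₁0, hC₁⟩ := exists_bound_deriv_smoothRamp
  obtain ⟨C₂, hC₂0, hC₂⟩ := exists_bound_deriv_smoothCutoff
  -- This compact set contains M plus every gradient used below, whatever δ is. Local boundedness of
  -- F thus gives a bound that survives the limit δ → 0.
  have hcomp : IsCompact ((fun q : ℝ × ℝ => M + q.1 • P + q.2 • P') ''
      (Icc (-(2 * C₁)) (2 * C₁) ×ˢ Icc (-(4 * C₂)) (4 * C₂))) :=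
    (isCompact_Icc.prod isCompact_Icc).image (by fun_prop)
  obtain ⟨C, hC⟩ := hF.locallyBounded _ hcomp
  set K : ℝ := max C |c| with hK
  have hK0 : 0 ≤ K := (abs_nonneg c).trans (le_max_right _ _)
  have key : ∀ δ : ℝ, 0 < δ → δ < 1 → F M ≤ c + 18 * K * δ := by
    intro δ hδ hδ1
    -- The cutoff creates gradients of order one near the two ends. A rectangle of length 1 / δ
    -- makes these ends a fraction of order δ of the whole.
    set L : ℝ := 1 / δ with hL
    have hδL : δ * L = 1 := mul_one_div_cancel hδ.ne'
    have hL0 : 0 < L := by positivity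
    obtain ⟨κ, hκ0, hκ, hκ'⟩ := exists_measure_rect e
    set Ω : Set (Fin 2 → ℝ) :=
      e ⁻¹' univ.pi fun i => Ioo (![-δ, -1] i) (![1 + 2 * δ, L + 1] i) with hΩ
    have memΩ : ∀ x, x ∈ Ω ↔ (-δ < e x 0 ∧ e x 0 < 1 + 2 * δ) ∧ -1 < e x 1 ∧ e x 1 < L + 1 := by
      intro x
      simp [hΩ, mem_pi, Fin.forall_fin_two]
    have hΩo : IsOpen Ω := (isOpen_set_pi finite_univ fun i _ => isOpen_Ioo).preimage e.continuous
    have hΩne : Ω.Nonempty := by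
      refine ⟨0, ?_⟩
      rw [memΩ]
      simp only [map_zero, Pi.zero_apply]
      refine ⟨⟨?_, ?_⟩, ?_, ?_⟩ <;> linarith
    have hΩb : Bornology.IsBounded Ω := by
      refine (isCompact_slantedRect (e := e) (-δ) (1 + 2 * δ) (-1) (L + 1)).isBounded.subset ?_
      intro x hx
      rw [memΩ] at hx
      rw [mem_slantedRect]
      exact ⟨⟨hx.1.1.le, hx.1.2.le⟩, hx.2.1.le, hx.2.2.le⟩
    set φ := laminate e p t δ L with hφ
    have hsupp := tsupport_laminate_subset (e := e) (p := p) (L := L) hδ ht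
    have hsuppΩ : tsupport φ ⊆ Ω := by
      intro x hx
      have := hsupp hx
      rw [mem_slantedRect] at this
      rw [memΩ]
      refine ⟨⟨?_, ?_⟩, ?_, ?_⟩ <;> linarith [this.1.1, this.1.2, this.2.1, this.2.2]
    have hcs : HasCompactSupport φ :=
      (isCompact_slantedRect (e := e) 0 (1 + δ) 0 L).of_isClosed_subset (isClosed_tsupport _) hsupp
    have havg := hF.le_average Ω hΩo hΩne hΩb φ (contDiff_laminate e p t δ L) hcs hsuppΩ M
    -- Three strips surround the kinks of the tent, two the ends of the cutoff; the strips also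
    -- absorb the margin between the support and the boundary of Ω. Elsewhere the gradient takes
    -- only the two laminate values.
    set bad : Set (Fin 2 → ℝ) := slantedRect e (-δ) δ (-1) (L + 1) ∪
      (slantedRect e t (t + δ) (-1) (L + 1) ∪ (slantedRect e 1 (1 + 2 * δ) (-1) (L + 1) ∪
      (slantedRect e (-δ) (1 + 2 * δ) (-1) 1 ∪
        slantedRect e (-δ) (1 + 2 * δ) (L - 1) (L + 1)))) with hbad
    have hΩvol : volume.real Ω = κ * ((1 + 3 * δ) * (L + 2)) := by
      rw [hΩ, hκ' _ _ _ _ (by linarith) (by linarith)]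
      ring
    have hΩpos : 0 < volume.real Ω :=
      ENNReal.toReal_pos (hΩo.measure_pos volume hΩne).ne' hΩb.measure_lt_top.ne
    -- With δL = 1 the areas of the strips sum to κ(9 + 22δ), while 9δ|Ω| = 9κ(1 + 3δ)(1 + 2δ).
    have hbadvol : volume.real bad ≤ 9 * δ * volume.real Ω := by
      calc volume.real bad ≤ κ * ((δ - -δ) * (L + 1 - -1)) + (κ * ((t + δ - t) * (L + 1 - -1)) +
            (κ * ((1 + 2 * δ - 1) * (L + 1 - -1)) + (κ * ((1 + 2 * δ - -δ) * (1 - -1)) +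
            κ * ((1 + 2 * δ - -δ) * (L + 1 - (L - 1)))))) := by
            rw [← hκ (-δ) δ (-1) (L + 1) (by linarith) (by linarith),
              ← hκ t (t + δ) (-1) (L + 1) (by linarith) (by linarith),
              ← hκ 1 (1 + 2 * δ) (-1) (L + 1) (by linarith) (by linarith),
              ← hκ (-δ) (1 + 2 * δ) (-1) 1 (by linarith) (by linarith),
              ← hκ (-δ) (1 + 2 * δ) (L - 1) (L + 1) (by linarith) (by linarith)]
            refine (measureReal_union_le _ _).trans (add_le_add le_rfl ?_)
            refine (measureReal_union_le _ _).trans (add_le_add le_rfl ?_)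
            refine (measureReal_union_le _ _).trans (add_le_add le_rfl ?_)
            exact measureReal_union_le _ _
        _ = κ * (9 + 22 * δ) := by linear_combination κ * 5 * hδL
        _ ≤ κ * (9 + 45 * δ + 54 * δ ^ 2) := by
            apply mul_le_mul_of_nonneg_left _ hκ0
            nlinarith
        _ = 9 * δ * volume.real Ω := by
            rw [hΩvol]
            linear_combination (-9 * κ * (1 + 3 * δ)) * hδL
    have hbadm : MeasurableSet bad := by
      have : ∀ α β γ ρ, MeasurableSet (slantedRect e α β γ ρ) := fun α β γ ρ =>
        (isCompact_slantedRect α β γ ρ).measurableSet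
      exact (this _ _ _ _).union ((this _ _ _ _).union ((this _ _ _ _).union
        ((this _ _ _ _).union (this _ _ _ _))))
    have hbound : ∀ x, |F (M + gradMat φ x)| ≤ K := by
      intro x
      refine (hC _ ?_).trans (le_max_left _ _)
      refine ⟨(deriv (smoothTent t δ) (e x 0) * smoothCutoff L (e x 1),
        smoothTent t δ (e x 0) * deriv (smoothCutoff L) (e x 1)), ⟨abs_le.1 ?_, abs_le.1 ?_⟩, ?_⟩
      · rw [abs_mul, ← mul_one (2 * C₁)]
        refine mul_le_mul ?_ (abs_smoothCutoff_le _ _) (abs_nonneg _) (by positivity)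
        rw [deriv_smoothTent]
        exact abs_tent_combination_le ht (hC₁ _ hδ _) (hC₁ _ hδ _) (hC₁ _ hδ _)
      · rw [abs_mul]
        exact mul_le_mul (abs_smoothTent_le hδ hδ1 ht _) (hC₂ _ _) (abs_nonneg _) (by positivity)
      · rw [hφ, gradMat_laminate]
        exact add_assoc _ _ _
    -- On the bad set F ≤ K ≤ c + 2K, because |c| ≤ K by the choice of K.
    have hpt : ∀ x ∈ Ω, F (M + gradMat φ x) ≤ c + bad.indicator (fun _ => 2 * K) x := by
      intro x hx
      by_cases hxb : x ∈ bad
      · rw [indicator_of_mem hxb]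
        have h1 := (abs_le.1 (hbound x)).2
        have h2 := (abs_le.1 (le_max_right C |c|)).1
        linarith
      · rw [indicator_of_notMem hxb, add_zero]
        rw [memΩ] at hx
        obtain ⟨⟨a1, a2⟩, a3, a4⟩ := hx
        simp only [hbad, mem_union, mem_slantedRect, not_or] at hxb
        obtain ⟨b1, b2, b3, b4, b5⟩ := hxb
        have c1 : δ < e x 0 := by
          by_contra! h
          exact b1 ⟨⟨a1.le, h⟩, a3.le, a4.le⟩
        have c2 : e x 0 < 1 := by
          by_contra! h
          exact b3 ⟨⟨h, a2.le⟩, a3.le, a4.le⟩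
        have c3 : e x 0 ∉ Icc t (t + δ) := fun h => b2 ⟨h, a3.le, a4.le⟩
        have c4 : 1 < e x 1 := by
          by_contra! h
          exact b4 ⟨⟨a1.le, a2.le⟩, a3.le, h⟩
        have c5 : e x 1 < L - 1 := by
          by_contra! h
          exact b5 ⟨⟨a1.le, a2.le⟩, h, a4.le⟩
        rw [hφ, gradMat_laminate, smoothCutoff_eq_one c4.le c5.le,
          deriv_smoothCutoff_eq_zero c4 c5, mul_one, mul_zero, zero_smul, add_zero]
        rcases deriv_smoothTent_eq hδ c1 c2 c3 with h | h <;> rw [h]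
        · exact hA
        · exact hB
    have hmeas : AEStronglyMeasurable (fun x => F (M + gradMat φ x)) volume := by
      let _ : MeasurableSpace Mat := _root_.borel Mat
      have : BorelSpace Mat := ⟨rfl⟩
      have h1 : Measurable fun x => M + gradMat φ x :=
        (continuous_const.add (continuous_gradMat (contDiff_laminate e p t δ L))).measurable
      have h2 : Measurable F := hF.borel
      exact (h2.comp h1).aestronglyMeasurable
    have hfin : volume Ω ≠ ⊤ := hΩb.measure_lt_top.ne
    have hint : IntegrableOn (fun x => F (M + gradMat φ x)) Ω :=
      Measure.integrableOn_of_bounded hfin hmeas (M := K)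
        (Filter.Eventually.of_forall fun x => hbound x)
    have hind : IntegrableOn (bad.indicator fun _ => 2 * K) Ω :=
      (integrableOn_const hfin enorm_ne_top).indicator hbadm
    have hconst : IntegrableOn (fun _ : Fin 2 → ℝ => c) Ω := integrableOn_const hfin (by simp)
    have hle : ∫ x in Ω, F (M + gradMat φ x) ≤ c * volume.real Ω + 2 * K * volume.real bad := by
      calc ∫ x in Ω, F (M + gradMat φ x)
          ≤ ∫ x in Ω, (c + bad.indicator (fun _ => 2 * K) x) :=
            setIntegral_mono_on hint (hconst.add hind) hΩo.measurableSet hpt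
        _ = c * volume.real Ω + 2 * K * (volume.restrict Ω).real bad := by
            rw [integral_add hconst hind, setIntegral_const, integral_indicator_const _ hbadm,
              smul_eq_mul, smul_eq_mul]
            ring
        _ ≤ c * volume.real Ω + 2 * K * volume.real bad := by
            gcongr
            have hbf : volume bad ≠ ⊤ := by
              have : ∀ α β γ ρ, volume (slantedRect e α β γ ρ) ≠ ⊤ := fun α β γ ρ =>
                (isCompact_slantedRect α β γ ρ).measure_lt_top.ne
              exact measure_union_ne_top (this _ _ _ _) (measure_union_ne_top (this _ _ _ _)
                (measure_union_ne_top (this _ _ _ _) (measure_union_ne_top (this _ _ _ _)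
                  (this _ _ _ _))))
            exact ENNReal.toReal_mono hbf (Measure.restrict_apply_le _ _)
    refine havg.trans ?_
    rw [inv_mul_le_iff₀ hΩpos]
    refine hle.trans ?_
    nlinarith [mul_le_mul_of_nonneg_left hbadvol (mul_nonneg two_pos.le hK0)]
  have hlim : Filter.Tendsto (fun δ : ℝ => c + 18 * K * δ) (nhdsWithin 0 (Ioi 0)) (nhds c) := by
    have : Filter.Tendsto (fun δ : ℝ => c + 18 * K * δ) (nhds 0) (nhds (c + 18 * K * 0)) :=
      (Continuous.tendsto (by fun_prop) 0)
    rw [mul_zero, add_zero] at this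
    exact this.mono_left nhdsWithin_le_nhds
  refine ge_of_tendsto hlim ?_
  filter_upwards [Ioo_mem_nhdsGT (one_pos (α := ℝ))] with δ hδ
  exact key δ hδ.1 hδ.2

end RankOne

/-! ### Rank-one matrices and compatibility as a determinant condition. -/

section Rank

theorem exists_vecMulVec_of_det_eq_zero {G : Mat} (h : G.det = 0) :
    ∃ p n : Fin 2 → ℝ, n ≠ 0 ∧ G = Matrix.vecMulVec p n := by
  rw [Matrix.det_fin_two] at h
  by_cases h0 : G 0 0 = 0 ∧ G 0 1 = 0
  · by_cases h1 : G 1 0 = 0 ∧ G 1 1 = 0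
    · refine ⟨0, ![1, 0], fun h => by simpa using congrFun h 0, ?_⟩
      ext i j
      fin_cases i <;> fin_cases j <;> simp [Matrix.vecMulVec_apply, h0, h1]
    · refine ⟨![0, 1], ![G 1 0, G 1 1], fun h => h1 ⟨congrFun h 0, congrFun h 1⟩, ?_⟩
      ext i j
      fin_cases i <;> fin_cases j <;> simp [Matrix.vecMulVec_apply, h0]
  · by_cases h00 : G 0 0 = 0
    · have h01 : G 0 1 ≠ 0 := fun h => h0 ⟨h00, h⟩
      refine ⟨![1, G 1 1 / G 0 1], ![G 0 0, G 0 1], fun h => h0 ⟨congrFun h 0, congrFun h 1⟩, ?_⟩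
      ext i j
      fin_cases i <;> fin_cases j <;> simp [Matrix.vecMulVec_apply]
      · rw [h00] at h ⊢
        have : G 0 1 * G 1 0 = 0 := by linarith
        simpa [h01] using this
      · field_simp
    · refine ⟨![1, G 1 0 / G 0 0], ![G 0 0, G 0 1], fun h => h0 ⟨congrFun h 0, congrFun h 1⟩, ?_⟩
      ext i j
      fin_cases i <;> fin_cases j <;> simp [Matrix.vecMulVec_apply]
      · field_simp
      · field_simp
        linarith

theorem rank_le_one_iff_det_eq_zero (G : Mat) : G.rank ≤ 1 ↔ G.det = 0 := by
  constructor
  · intro h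
    by_contra hd
    have := Matrix.rank_of_isUnit G ((Matrix.isUnit_iff_isUnit_det G).2 (isUnit_iff_ne_zero.2 hd))
    simp at this
    omega
  · intro h
    obtain ⟨p, n, -, rfl⟩ := exists_vecMulVec_of_det_eq_zero h
    exact Matrix.rank_vecMulVec_le p n

/-- A linear change of coordinates with prescribed first coordinate. -/
theorem exists_equiv_first_coordinate {n : Fin 2 → ℝ} (hn : n ≠ 0) :
    ∃ e : (Fin 2 → ℝ) ≃L[ℝ] (Fin 2 → ℝ), (fun j => e (Pi.single j 1) 0) = n := by
  -- The second row is the first one rotated, so the determinant is |n|².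
  set A : Mat := !![n 0, n 1; -n 1, n 0] with hA
  have hdet : IsUnit A.det := by
    rw [isUnit_iff_ne_zero, hA, Matrix.det_fin_two_of]
    intro h
    have h0 : n 0 = 0 := by nlinarith [sq_nonneg (n 0), sq_nonneg (n 1)]
    have h1 : n 1 = 0 := by nlinarith [sq_nonneg (n 0), sq_nonneg (n 1)]
    exact hn (by ext j; fin_cases j <;> assumption)
  have hdet' : IsUnit (LinearMap.det (Matrix.toLin' A)) := by rwa [LinearMap.det_toLin']
  refine ⟨(LinearEquiv.ofIsUnitDet (f := Matrix.toLin' A) (v := Pi.basisFun ℝ (Fin 2))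
    (v' := Pi.basisFun ℝ (Fin 2)) ?_).toContinuousLinearEquiv, ?_⟩
  · simpa [LinearMap.toMatrix_eq_toMatrix'] using hdet
  · ext j
    fin_cases j <;> simp [hA, Matrix.mulVec, dotProduct]

/-- Symmetric matrices are compatible exactly when the determinant of their difference is
nonpositive. -/
theorem compatible_iff {A B : Mat} (hA : A.IsSymm) (hB : B.IsSymm) :
    Compatible A B ↔ (A - B).det ≤ 0 := by
  have hAB : (A - B) 1 0 = (A - B) 0 1 := (hA.sub hB).apply 0 1
  constructor
  · rintro ⟨S, hS, hr⟩
    rw [rank_le_one_iff_det_eq_zero, Matrix.det_fin_two] at hr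
    have h00 := congrFun (congrFun hS 0) 0
    have h11 := congrFun (congrFun hS 1) 1
    have h01 := congrFun (congrFun hS 0) 1
    simp only [Matrix.transpose_apply, Matrix.neg_apply] at h00 h11 h01
    have e0 : S 0 0 = 0 := by linarith
    have e1 : S 1 1 = 0 := by linarith
    rw [Matrix.add_apply, Matrix.add_apply, Matrix.add_apply, Matrix.add_apply, e0, e1, h01,
      hAB] at hr
    rw [Matrix.det_fin_two, hAB]
    nlinarith [sq_nonneg (S 0 1)]
  · intro h
    rw [Matrix.det_fin_two, hAB] at h
    -- Adding a skew matrix with entries ±s to a symmetric one raises its determinant by s², so s²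
    -- must be minus the determinant.
    set s := Real.sqrt (-((A - B) 0 0 * (A - B) 1 1 - (A - B) 0 1 * (A - B) 0 1)) with hs
    have hss : s * s = -((A - B) 0 0 * (A - B) 1 1 - (A - B) 0 1 * (A - B) 0 1) :=
      Real.mul_self_sqrt (by linarith)
    refine ⟨!![0, s; -s, 0], ?_, ?_⟩
    · ext i j
      fin_cases i <;> fin_cases j <;> simp
    · rw [rank_le_one_iff_det_eq_zero, Matrix.det_fin_two]
      simp only [Matrix.add_apply, hAB, Matrix.of_apply, Matrix.cons_val', Matrix.cons_val_zero,
        Matrix.cons_val_one, Matrix.cons_val_fin_one]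
      linarith

end Rank

/-! ### The lamination hull is contained in the quasiconvex and convex hulls. -/

section LaminationHull

/-- The laminate is built between A + S and B, whose difference has rank at most one. Taking
symmetric parts removes S from both the end point and the average. -/
theorem IsSymQuasiconvex.le_of_compatible {f : Mat → ℝ} (hf : IsSymQuasiconvex f) {A B : Mat}
    (hA : A.IsSymm) (hB : B.IsSymm) (hAB : Compatible A B) {t c : ℝ} (ht : t ∈ Icc (0 : ℝ) 1)
    (hfA : f A ≤ c) (hfB : f B ≤ c) : f (t • A + (1 - t) • B) ≤ c := by
  obtain ⟨S, hS, hr⟩ := hAB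
  rw [rank_le_one_iff_det_eq_zero] at hr
  obtain ⟨p, n, hn, hR⟩ := exists_vecMulVec_of_det_eq_zero hr
  obtain ⟨e, he⟩ := exists_equiv_first_coordinate hn
  have key := IsQuasiconvex.le_of_rankOne hf e p (c := c) ht (B + t • (A - B + S))
  rw [he, ← hR] at key
  have e1 : B + t • (A - B + S) + (1 - t) • (A - B + S) = A + S := by
    rw [sub_smul, one_smul]; abel
  have e2 : B + t • (A - B + S) + (-t) • (A - B + S) = B := by
    rw [neg_smul]; abel
  have e3 : symPart (A + S) = A := by
    rw [symPart, Matrix.transpose_add, hS, hA.eq, show A + S + (A + -S) = (2 : ℝ) • A by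
      rw [two_smul]; abel, smul_smul]
    norm_num
  have e4 : symPart (B + t • (A - B + S)) = t • A + (1 - t) • B := by
    rw [symPart, Matrix.transpose_add, Matrix.transpose_smul, Matrix.transpose_add,
      Matrix.transpose_sub, hS, hA.eq, hB.eq]
    module
  simp only [e1, e2, e3, e4, symPart_of_isSymm hB] at key
  exact key hfA hfB

theorem symLamination_subset_succ (𝒰 : Set Mat) (i : ℕ) :
    symLamination 𝒰 i ⊆ symLamination 𝒰 (i + 1) := fun A hA =>
  ⟨A, hA, A, hA, ⟨0, by simp, by simp⟩, 1, by simp, by simp⟩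

theorem subset_symLaminationHull (𝒰 : Set Mat) : 𝒰 ⊆ symLaminationHull 𝒰 :=
  subset_iUnion (symLamination 𝒰) 0

theorem mem_symLaminationHull_of_compatible {𝒰 : Set Mat} {A B : Mat}
    (hA : A ∈ symLaminationHull 𝒰) (hB : B ∈ symLaminationHull 𝒰) (hAB : Compatible A B) {t : ℝ}
    (ht : t ∈ Icc (0 : ℝ) 1) : t • A + (1 - t) • B ∈ symLaminationHull 𝒰 := by
  have mono : Monotone (symLamination 𝒰) := monotone_nat_of_le_succ (symLamination_subset_succ 𝒰)
  obtain ⟨i, hi⟩ := mem_iUnion.1 hA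
  obtain ⟨j, hj⟩ := mem_iUnion.1 hB
  exact mem_iUnion.2 ⟨max i j + 1, A, mono (le_max_left i j) hi, B, mono (le_max_right i j) hj, hAB,
    t, ht, rfl⟩

theorem symLaminationHull_subset_symQuasiconvexHull {𝒰 : Set Mat} (h : ∀ U ∈ 𝒰, U.IsSymm) :
    symLaminationHull 𝒰 ⊆ symQuasiconvexHull 𝒰 := by
  refine iUnion_subset fun i => ?_
  induction i with
  | zero => exact fun A hA => ⟨h A hA, fun f _ c hc => hc A hA⟩
  | succ i ih =>
    rintro _ ⟨A, hA, B, hB, hAB, t, ht, rfl⟩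
    have hA' := ih hA
    have hB' := ih hB
    exact ⟨(hA'.1.smul t).add (hB'.1.smul (1 - t)), fun f hf c hc =>
      hf.le_of_compatible hA'.1 hB'.1 hAB ht (hA'.2 f hf c hc) (hB'.2 f hf c hc)⟩

theorem symLaminationHull_subset_convexHull (𝒰 : Set Mat) :
    symLaminationHull 𝒰 ⊆ convexHull ℝ 𝒰 := by
  refine iUnion_subset fun i => ?_
  induction i with
  | zero => exact subset_convexHull ℝ 𝒰
  | succ i ih =>
    rintro _ ⟨A, hA, B, hB, -, t, ht, rfl⟩
    exact convex_convexHull ℝ 𝒰 (ih hA) (ih hB) ht.1 (by linarith [ht.2]) (by ring)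

end LaminationHull

/-! ### Coordinates in the plane of the wells. -/

section Coordinates

/-- Coordinates on the plane through `V` spanned by the tensors of `a` and `n`, oriented so that
compatibility becomes comparability for the product order. -/
noncomputable def planeMap (a n : Fin 2 → ℝ) (V : Mat) (p : ℝ × ℝ) : Mat :=
  V + p.1 • perpTensor a - p.2 • perpTensor n

/-- The determinant of two vectors. -/
def cross (a n : Fin 2 → ℝ) : ℝ := a 0 * n 1 - a 1 * n 0

/-- The quadratic form of a matrix. -/
def quadForm (M : Mat) (v : Fin 2 → ℝ) : ℝ :=
  v 0 * v 0 * M 0 0 + v 0 * v 1 * M 0 1 + v 1 * v 0 * M 1 0 + v 1 * v 1 * M 1 1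

/-- The inverse of `planeMap`. -/
noncomputable def planeCoord (a n : Fin 2 → ℝ) (V M : Mat) : ℝ × ℝ :=
  (quadForm (M - V) n / cross a n ^ 2, -(quadForm (M - V) a / cross a n ^ 2))

theorem perpTensor_apply (v : Fin 2 → ℝ) : perpTensor v 0 0 = v 1 * v 1 ∧
    perpTensor v 0 1 = -(v 0 * v 1) ∧ perpTensor v 1 0 = -(v 0 * v 1) ∧
      perpTensor v 1 1 = v 0 * v 0 := by
  simp [perpTensor, perp, Matrix.vecMulVec_apply, mul_comm]

theorem isSymm_perpTensor (v : Fin 2 → ℝ) : (perpTensor v).IsSymm := by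
  ext i j
  simp [perpTensor, Matrix.vecMulVec_apply, mul_comm]

theorem frobInner_eq (M N : Mat) :
    frobInner M N = M 0 0 * N 0 0 + M 0 1 * N 0 1 + M 1 0 * N 1 0 + M 1 1 * N 1 1 := by
  simp [frobInner, Matrix.trace_fin_two, Matrix.mul_apply]
  ring

variable {a n : Fin 2 → ℝ} {V : Mat}

theorem planeMap_apply (p : ℝ × ℝ) (i j : Fin 2) : planeMap a n V p i j =
    V i j + p.1 * perpTensor a i j - p.2 * perpTensor n i j := by
  simp [planeMap]

theorem isSymm_planeMap (hV : V.IsSymm) (p : ℝ × ℝ) : (planeMap a n V p).IsSymm :=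
  (hV.add ((isSymm_perpTensor a).smul _)).sub ((isSymm_perpTensor n).smul _)

theorem planeMap_zero : planeMap a n V 0 = V := by simp [planeMap]

theorem det_planeMap_sub (p q : ℝ × ℝ) : (planeMap a n V p - planeMap a n V q).det =
    -((p.1 - q.1) * (p.2 - q.2) * cross a n ^ 2) := by
  obtain ⟨a00, a01, a10, a11⟩ := perpTensor_apply a
  obtain ⟨n00, n01, n10, n11⟩ := perpTensor_apply n
  simp only [Matrix.det_fin_two, Matrix.sub_apply, planeMap_apply, a00, a01, a10, a11, n00, n01,
    n10, n11, cross]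
  ring

theorem comparable_iff {p q : ℝ × ℝ} : Comparable p q ↔ 0 ≤ (p.1 - q.1) * (p.2 - q.2) := by
  rw [mul_nonneg_iff, sub_nonneg, sub_nonneg, sub_nonpos, sub_nonpos]
  exact Or.comm

theorem compatible_planeMap_iff (hV : V.IsSymm) (hd : cross a n ≠ 0) {p q : ℝ × ℝ} :
    Compatible (planeMap a n V p) (planeMap a n V q) ↔ Comparable p q := by
  rw [compatible_iff (isSymm_planeMap hV p) (isSymm_planeMap hV q), det_planeMap_sub,
    comparable_iff, neg_nonpos, mul_nonneg_iff_of_pos_right (by positivity)]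

theorem rankOneCompatible_planeMap_iff (hd : cross a n ≠ 0) {p q : ℝ × ℝ} :
    RankOneCompatible (planeMap a n V p) (planeMap a n V q) ↔ Aligned p q := by
  rw [RankOneCompatible, rank_le_one_iff_det_eq_zero, det_planeMap_sub, neg_eq_zero, mul_eq_zero,
    mul_eq_zero, sub_eq_zero, sub_eq_zero, Aligned]
  simp [hd]

/-- The quadratic form at n annihilates n^⊥ ⊗ n^⊥ and equals `cross a n ^ 2` on a^⊥ ⊗ a^⊥; the form
at a does the reverse. -/
theorem planeCoord_planeMap (hd : cross a n ≠ 0) (p : ℝ × ℝ) :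
    planeCoord a n V (planeMap a n V p) = p := by
  obtain ⟨a00, a01, a10, a11⟩ := perpTensor_apply a
  obtain ⟨n00, n01, n10, n11⟩ := perpTensor_apply n
  ext
  · simp only [planeCoord, quadForm, Matrix.sub_apply, planeMap_apply, a00, a01, a10, a11, n00, n01,
      n10, n11]
    rw [div_eq_iff (by positivity), cross]
    ring
  · simp only [planeCoord, quadForm, Matrix.sub_apply, planeMap_apply, a00, a01, a10, a11, n00, n01,
      n10, n11]
    rw [neg_eq_iff_eq_neg, div_eq_iff (by positivity), cross]
    ring

theorem planeMap_planeCoord {Q M : Mat} {δ : ℝ} (hQ : Q.IsSymm) (hdet : Q.det < 0)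
    (hd : cross a n ≠ 0) (ha : frobInner Q (perpTensor a) = 0) (hn : frobInner Q (perpTensor n) = 0)
    (hV : V.IsSymm) (hVδ : frobInner Q V = δ) (hM : M.IsSymm) (hMδ : frobInner Q M = δ) :
    planeMap a n V (planeCoord a n V M) = M := by
  obtain ⟨a00, a01, a10, a11⟩ := perpTensor_apply a
  obtain ⟨n00, n01, n10, n11⟩ := perpTensor_apply n
  have hQ' : Q 1 0 = Q 0 1 := hQ.apply 0 1
  obtain ⟨D, hD⟩ : ∃ D, D = M - V := ⟨_, rfl⟩
  have hD' : D 1 0 = D 0 1 := by rw [hD]; exact (hM.sub hV).apply 0 1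
  have hDδ : Q 0 0 * D 0 0 + 2 * Q 0 1 * D 0 1 + Q 1 1 * D 1 1 = 0 := by
    rw [frobInner_eq] at hVδ hMδ
    have hM' : M 1 0 = M 0 1 := hM.apply 0 1
    have hV' : V 1 0 = V 0 1 := hV.apply 0 1
    rw [hM', hQ'] at hMδ
    rw [hV', hQ'] at hVδ
    simp only [hD, Matrix.sub_apply]
    linarith
  rw [frobInner_eq, a00, a01, a10, a11, hQ'] at ha
  rw [frobInner_eq, n00, n01, n10, n11, hQ'] at hn
  rw [Matrix.det_fin_two, hQ'] at hdet
  -- b is the polar form of Q at the two rank-one directions. As both are isotropic for Q, b² = -det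
  -- Q · (cross a n)² > 0.
  obtain ⟨b, hb⟩ : ∃ b, b = Q 0 0 * (a 1 * n 1) - Q 0 1 * (a 0 * n 1 + a 1 * n 0) +
    Q 1 1 * (a 0 * n 0) := ⟨_, rfl⟩
  have hb2 : b ^ 2 = -((Q 0 0 * Q 1 1 - Q 0 1 * Q 0 1) * cross a n ^ 2) := by
    rw [hb, cross]
    linear_combination (Q 0 0 * (n 1 * n 1) + Q 0 1 * -(n 0 * n 1) + Q 0 1 * -(n 0 * n 1) +
      Q 1 1 * (n 0 * n 0)) * ha
  have hb0 : b ≠ 0 := by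
    intro h
    rw [h] at hb2
    have : 0 < cross a n ^ 2 := by positivity
    nlinarith
  -- Orthogonality to Q reduces to b times the mixed entry aᵀDn, so this entry vanishes and D has no
  -- component outside the two tensors.
  have hm : a 0 * n 0 * D 0 0 + (a 0 * n 1 + a 1 * n 0) * D 0 1 + a 1 * n 1 * D 1 1 = 0 := by
    have : b * (a 0 * n 0 * D 0 0 + (a 0 * n 1 + a 1 * n 0) * D 0 1 + a 1 * n 1 * D 1 1) = 0 := by
      rw [hb]
      linear_combination
        (1 / 2 * (n 0 ^ 2 * D 0 0 + 2 * (n 0 * n 1) * D 0 1 + n 1 ^ 2 * D 1 1)) * ha +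
        (1 / 2 * (a 0 ^ 2 * D 0 0 + 2 * (a 0 * a 1) * D 0 1 + a 1 ^ 2 * D 1 1)) * hn -
        (1 / 2 * (a 0 * n 1 - a 1 * n 0) ^ 2) * hDδ
    exact (mul_eq_zero.1 this).resolve_left hb0
  have hd2 : cross a n ^ 2 ≠ 0 := by positivity
  have key : ∀ i j, cross a n ^ 2 * D i j =
      quadForm D n * perpTensor a i j + quadForm D a * perpTensor n i j := by
    intro i j
    fin_cases i <;> fin_cases j <;>
      simp only [Fin.zero_eta, Fin.mk_one, a00, a01, a10, a11, n00, n01, n10, n11, quadForm, cross,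
        hD']
    · linear_combination (-2 * a 1 * n 1) * hm
    · linear_combination (a 0 * n 1 + a 1 * n 0) * hm
    · linear_combination (a 0 * n 1 + a 1 * n 0) * hm
    · linear_combination (-2 * a 0 * n 0) * hm
  ext i j
  rw [planeMap_apply, planeCoord, ← hD]
  have hMV : M i j = V i j + D i j := by rw [hD]; simp
  rw [hMV]
  simp only
  field_simp
  linear_combination -key i j

/-- The coordinates as an affine map. -/
noncomputable def planeAffineMap (a n : Fin 2 → ℝ) (V : Mat) : (ℝ × ℝ) →ᵃ[ℝ] Mat where
  toFun := planeMap a n V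
  linear := (LinearMap.fst ℝ ℝ ℝ).smulRight (perpTensor a) -
    (LinearMap.snd ℝ ℝ ℝ).smulRight (perpTensor n)
  map_vadd' p v := by
    simp [planeMap]
    module

theorem cross_ne_zero_of_linearIndependent (h : LinearIndependent ℝ ![a, n]) : cross a n ≠ 0 := by
  rw [LinearIndependent.pair_iff] at h
  intro hc
  rw [cross] at hc
  have h0 := h (n 0) (-a 0) (by ext i; fin_cases i <;> simp <;> linarith)
  have h1 := h (n 1) (-a 1) (by ext i; fin_cases i <;> simp <;> linarith)
  have := h 1 0 (by
    ext i
    fin_cases i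
    · simpa using h0.2
    · simpa using h1.2)
  exact one_ne_zero this.1

theorem linearIndependent_of_cross_ne_zero (h : cross a n ≠ 0) : LinearIndependent ℝ ![a, n] := by
  rw [LinearIndependent.pair_iff]
  intro s t hst
  have h0 := congrFun hst 0
  have h1 := congrFun hst 1
  simp at h0 h1
  have hs : s * cross a n = 0 := by rw [cross]; linear_combination n 1 * h0 - n 0 * h1
  have ht : t * cross a n = 0 := by rw [cross]; linear_combination a 0 * h1 - a 1 * h0
  exact ⟨(mul_eq_zero.1 hs).resolve_right h, (mul_eq_zero.1 ht).resolve_right h⟩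

theorem AreRankOneDirections.swap {Q : Mat} (h : AreRankOneDirections Q a n) :
    AreRankOneDirections Q n a := by
  refine ⟨h.unit_n, h.unit_a, linearIndependent_of_cross_ne_zero fun hc => ?_, h.orthogonal_n,
    h.orthogonal_a⟩
  apply cross_ne_zero_of_linearIndependent h.linearIndependent
  rw [cross] at *
  linarith

theorem frobInner_perpTensor {Q : Mat} (hQ : Q.IsSymm) (v : Fin 2 → ℝ) :
    frobInner Q (perpTensor v) = Q 0 0 * (v 1 * v 1) - 2 * Q 0 1 * (v 0 * v 1) +
      Q 1 1 * (v 0 * v 0) := by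
  obtain ⟨v00, v01, v10, v11⟩ := perpTensor_apply v
  rw [frobInner_eq, v00, v01, v10, v11, show Q 1 0 = Q 0 1 from hQ.apply 0 1]
  ring

theorem exists_areRankOneDirections_of_cross {Q : Mat} (hQ : Q.IsSymm) {v w : Fin 2 → ℝ}
    (hc : cross v w ≠ 0) (hv : frobInner Q (perpTensor v) = 0)
    (hw : frobInner Q (perpTensor w) = 0) : ∃ a n, AreRankOneDirections Q a n := by
  have norm : ∀ u : Fin 2 → ℝ, u ≠ 0 → ∃ r : ℝ, r ≠ 0 ∧ (r • u) ⬝ᵥ (r • u) = 1 := by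
    intro u hu
    have hpos : 0 < u ⬝ᵥ u := by
      have := Matrix.dotProduct_star_self_pos_iff.2 hu
      simpa using this
    refine ⟨(Real.sqrt (u ⬝ᵥ u))⁻¹, by positivity, ?_⟩
    rw [smul_dotProduct, dotProduct_smul, smul_eq_mul, smul_eq_mul, ← mul_assoc, ← mul_inv,
      Real.mul_self_sqrt hpos.le, inv_mul_cancel₀ hpos.ne']
  obtain ⟨r, hr, hr1⟩ := norm v (by rintro rfl; simp [cross] at hc)
  obtain ⟨s, hs, hs1⟩ := norm w (by rintro rfl; simp [cross] at hc)
  refine ⟨r • v, s • w, hr1, hs1, linearIndependent_of_cross_ne_zero ?_, ?_, ?_⟩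
  · have : cross (r • v) (s • w) = r * s * cross v w := by simp [cross]; ring
    rw [this]
    positivity
  · rw [frobInner_perpTensor hQ] at *
    simp
    linear_combination r ^ 2 * hv
  · rw [frobInner_perpTensor hQ] at *
    simp
    linear_combination s ^ 2 * hw

/-- A plane whose normal has negative determinant contains two rank-one directions. -/
theorem exists_areRankOneDirections {Q : Mat} (hQ : Q.IsSymm) (hdet : Q.det < 0) :
    ∃ a n, AreRankOneDirections Q a n := by
  rw [Matrix.det_fin_two, show Q 1 0 = Q 0 1 from hQ.apply 0 1] at hdet
  by_cases h : Q 0 0 = 0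
  · have hb : Q 0 1 ≠ 0 := by
      intro hb
      simp [h, hb] at hdet
    -- With Q₀₀ = 0 the isotropy equation factors as v₀(Q₁₁v₀ - 2Q₀₁v₁) = 0.
    refine exists_areRankOneDirections_of_cross hQ (v := ![0, 1]) (w := ![2 * Q 0 1, Q 1 1])
      (by simp [cross, hb]) ?_ ?_
    · simp [frobInner_perpTensor hQ, h]
    · simp [frobInner_perpTensor hQ, h]
      ring
  · obtain ⟨s, hs⟩ : ∃ s, s = Real.sqrt (Q 0 1 * Q 0 1 - Q 0 0 * Q 1 1) := ⟨_, rfl⟩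
    have hss : s * s = Q 0 1 * Q 0 1 - Q 0 0 * Q 1 1 := by
      rw [hs]
      exact Real.mul_self_sqrt (by linarith)
    have hs0 : s ≠ 0 := by
      rintro rfl
      linarith
    -- These are the two roots of the quadratic isotropy equation, with s² = -det Q.
    refine exists_areRankOneDirections_of_cross hQ (v := ![Q 0 0, Q 0 1 + s])
      (w := ![Q 0 0, Q 0 1 - s]) ?_ ?_ ?_
    · have : cross ![Q 0 0, Q 0 1 + s] ![Q 0 0, Q 0 1 - s] = -2 * Q 0 0 * s := by
        simp [cross]; ring
      rw [this]
      simp [h, hs0]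
    · simp [frobInner_perpTensor hQ]
      linear_combination Q 0 0 * hss
    · simp [frobInner_perpTensor hQ]
      linear_combination Q 0 0 * hss

end Coordinates

/-! ### From the quasiconvex hull to the planar outer hull. -/

section Outer

theorem mem_convexHull_of_halfPlanes {S : Set (ℝ × ℝ)} (hS : S.Finite) {z : ℝ × ℝ}
    (h : ∀ α β γ : ℝ, (∀ s ∈ S, α * s.1 + β * s.2 ≤ γ) → α * z.1 + β * z.2 ≤ γ) :
    z ∈ convexHull ℝ S := by
  by_contra hz
  obtain ⟨f, u, hfz, hfu⟩ := geometric_hahn_banach_point_closed (convex_convexHull ℝ S)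
    (hS.isClosed_convexHull ℝ) hz
  have hf : ∀ p : ℝ × ℝ, f p = f (1, 0) * p.1 + f (0, 1) * p.2 := by
    intro p
    have : p = p.1 • ((1 : ℝ), (0 : ℝ)) + p.2 • ((0 : ℝ), (1 : ℝ)) := by ext <;> simp
    conv_lhs => rw [this]
    rw [map_add, map_smul, map_smul, smul_eq_mul, smul_eq_mul]
    ring
  have := h (-f (1, 0)) (-f (0, 1)) (-u) fun s hs => by
    have := hfu s (subset_convexHull ℝ S hs)
    rw [hf] at this
    linarith
  rw [hf] at hfz
  linarith

variable {a n : Fin 2 → ℝ} {V : Mat}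

/-- The coefficients represent the functional dual to the coordinates: r times the quadratic form at
n minus s times the one at a, divided by `cross a n ^ 2`. The off-diagonal coefficient is doubled
because only the entry (0, 1) is used. -/
theorem detQuad_zero_planeMap (hd : cross a n ≠ 0) (r s : ℝ) (p : ℝ × ℝ) :
    detQuad 0 ((r * n 0 ^ 2 - s * a 0 ^ 2) / cross a n ^ 2)
      ((r * n 1 ^ 2 - s * a 1 ^ 2) / cross a n ^ 2)
      (2 * (r * n 0 * n 1 - s * a 0 * a 1) / cross a n ^ 2) (planeMap a n V p) =
    detQuad 0 ((r * n 0 ^ 2 - s * a 0 ^ 2) / cross a n ^ 2)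
      ((r * n 1 ^ 2 - s * a 1 ^ 2) / cross a n ^ 2)
      (2 * (r * n 0 * n 1 - s * a 0 * a 1) / cross a n ^ 2) V + (r * p.1 + s * p.2) := by
  obtain ⟨a00, a01, -, a11⟩ := perpTensor_apply a
  obtain ⟨n00, n01, -, n11⟩ := perpTensor_apply n
  simp only [detQuad, planeMap_apply, a00, a01, a11, n00, n01, n11]
  field_simp
  rw [cross]
  ring

/-- Suitable linear terms recentre -det at P. Under `planeMap` this is the product test function
centred at the coordinates of P. -/
theorem detQuad_one_eq {P M : Mat} (hP : P.IsSymm) (hM : M.IsSymm) :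
    detQuad 1 (P 1 1) (P 0 0) (-2 * P 0 1) M = P.det - (M - P).det := by
  simp only [detQuad, Matrix.det_fin_two, Matrix.sub_apply, show P 1 0 = P 0 1 from hP.apply 0 1,
    show M 1 0 = M 0 1 from hM.apply 0 1]
  ring

theorem isOuter_of_mem_symQuasiconvexHull (hV : V.IsSymm) (hd : cross a n ≠ 0) {S : Set (ℝ × ℝ)}
    (hS : S.Finite) {z : ℝ × ℝ}
    (hz : planeMap a n V z ∈ symQuasiconvexHull (planeMap a n V '' S)) : IsOuter S z := by
  refine ⟨mem_convexHull_of_halfPlanes hS fun r s γ h => ?_, fun x₀ y₀ c h => ?_⟩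
  · have := detQuad_le_of_mem_hull hz le_rfl ((r * n 0 ^ 2 - s * a 0 ^ 2) / cross a n ^ 2)
      ((r * n 1 ^ 2 - s * a 1 ^ 2) / cross a n ^ 2)
      (2 * (r * n 0 * n 1 - s * a 0 * a 1) / cross a n ^ 2)
      (detQuad 0 ((r * n 0 ^ 2 - s * a 0 ^ 2) / cross a n ^ 2)
        ((r * n 1 ^ 2 - s * a 1 ^ 2) / cross a n ^ 2)
        (2 * (r * n 0 * n 1 - s * a 0 * a 1) / cross a n ^ 2) V + γ) (by
      rintro _ ⟨p, hp, rfl⟩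
      rw [detQuad_zero_planeMap hd]
      linarith [h p hp])
    rw [detQuad_zero_planeMap hd] at this
    linarith
  · obtain ⟨P, hP⟩ : ∃ P, P = planeMap a n V (x₀, y₀) := ⟨_, rfl⟩
    have hPs : P.IsSymm := hP ▸ isSymm_planeMap hV _
    have e : ∀ p, detQuad 1 (P 1 1) (P 0 0) (-2 * P 0 1) (planeMap a n V p) =
        P.det + (p.1 - x₀) * (p.2 - y₀) * cross a n ^ 2 := by
      intro p
      rw [detQuad_one_eq hPs (isSymm_planeMap hV p), hP, det_planeMap_sub]
      ring
    have hd2 : 0 < cross a n ^ 2 := by positivity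
    have := detQuad_le_of_mem_hull hz zero_le_one (P 1 1) (P 0 0) (-2 * P 0 1)
      (P.det + c * cross a n ^ 2) (by
      rintro _ ⟨p, hp, rfl⟩
      rw [e]
      have := mul_le_mul_of_nonneg_right (h p hp) hd2.le
      linarith)
    rw [e] at this
    exact le_of_mul_le_mul_right (by linarith) hd2

theorem lamClosed_preimage (hV : V.IsSymm) (hd : cross a n ≠ 0) (𝒰 : Set Mat) :
    LamClosed (planeMap a n V ⁻¹' symLaminationHull 𝒰) := by
  rintro p hp q hq hpq _ ⟨s, t, hs, ht, hst, rfl⟩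
  have hc := (compatible_planeMap_iff hV hd).2 (Or.inl hpq : Comparable p q)
  have := mem_symLaminationHull_of_compatible hp hq hc (t := s) ⟨hs, by linarith⟩
  rw [mem_preimage]
  convert this using 1
  obtain rfl : t = 1 - s := by linarith
  simp only [planeMap, Prod.fst_add, Prod.smul_fst, Prod.snd_add, Prod.smul_snd, smul_eq_mul]
  module

/-- A linear functional and its negative are both symmetric quasiconvex, so a value shared by all
wells is kept on the hull. -/
theorem frobInner_eq_of_mem_hull {Q A : Mat} {δ : ℝ} {𝒰 : Set Mat} (h : IsCoplanarWith Q δ 𝒰)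
    (hA : A ∈ symQuasiconvexHull 𝒰) : frobInner Q A = δ := by
  have e : ∀ (c : ℝ) {M : Mat}, M.IsSymm →
      detQuad 0 (c * Q 0 0) (c * Q 1 1) (c * (2 * Q 0 1)) M = c * frobInner Q M := by
    intro c M hM
    rw [frobInner_eq, detQuad, show Q 1 0 = Q 0 1 from h.normal_symm.apply 0 1,
      show M 1 0 = M 0 1 from hM.apply 0 1]
    ring
  have key : ∀ c : ℝ, c * frobInner Q A ≤ c * δ := by
    intro c
    rw [← e c hA.1]
    refine detQuad_le_of_mem_hull hA le_rfl _ _ _ _ fun B hB => ?_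
    rw [e c (h.wells_symm B hB), h.mem_plane B hB]
  linarith [key 1, key (-1)]

/-- The lamination hull is the quasiconvex hull if the coordinates of the wells form a determined
set. -/
theorem symLaminationHull_eq_of_determined {Q : Mat} {δ : ℝ} {𝒰 : Set Mat}
    (h : IsCoplanarWith Q δ 𝒰) (hdet : Q.det < 0) (hfin : 𝒰.Finite)
    (hdir : AreRankOneDirections Q a n) (hV : V ∈ 𝒰)
    (hdt : Determined (planeCoord a n V '' 𝒰)) : symLaminationHull 𝒰 = symQuasiconvexHull 𝒰 := by
  refine (symLaminationHull_subset_symQuasiconvexHull h.wells_symm).antisymm fun A hA => ?_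
  have hd := cross_ne_zero_of_linearIndependent hdir.linearIndependent
  have hVs := h.wells_symm V hV
  have hinv : ∀ {M : Mat}, M.IsSymm → frobInner Q M = δ →
      planeMap a n V (planeCoord a n V M) = M := fun hM hMδ =>
    planeMap_planeCoord h.normal_symm hdet hd hdir.orthogonal_a hdir.orthogonal_n hVs
      (h.mem_plane V hV) hM hMδ
  have himg : planeMap a n V '' (planeCoord a n V '' 𝒰) = 𝒰 := by
    rw [image_image]
    refine (image_congr fun M hM => hinv (h.wells_symm M hM) (h.mem_plane M hM)).trans ?_
    exact image_id' _
  have hA2 := hinv hA.1 (frobInner_eq_of_mem_hull h hA)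
  have hout : IsOuter (planeCoord a n V '' 𝒰) (planeCoord a n V A) := by
    apply isOuter_of_mem_symQuasiconvexHull hVs hd (hfin.image _)
    rw [himg, hA2]
    exact hA
  have := hdt _ (lamClosed_preimage hVs hd 𝒰) (by
    rintro _ ⟨M, hM, rfl⟩
    rw [mem_preimage, hinv (h.wells_symm M hM) (h.mem_plane M hM)]
    exact subset_symLaminationHull 𝒰 hM) _ hout
  rwa [mem_preimage, hA2] at this

end Outer

/-! ### Interior points of triangles and wedge configurations. -/

section Wedge

/-- On the affine span of the image, `planeCoord` is a continuous inverse of `planeMap`; the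
preimage of the planar interior is a relatively open neighbourhood. -/
theorem planeMap_mem_intrinsicInterior {a n : Fin 2 → ℝ} {V : Mat} (hd : cross a n ≠ 0)
    {T : Set (ℝ × ℝ)} {z : ℝ × ℝ} (hz : z ∈ interior T) :
    planeMap a n V z ∈ intrinsicInterior ℝ (planeMap a n V '' T) := by
  rw [mem_intrinsicInterior]
  refine ⟨⟨planeMap a n V z, subset_affineSpan ℝ _ (mem_image_of_mem _ (interior_subset hz))⟩, ?_,
    rfl⟩
  rw [mem_interior]
  have hcont : Continuous (planeCoord a n V) := by
    unfold planeCoord quadForm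
    fun_prop
  refine ⟨(fun y : affineSpan ℝ (planeMap a n V '' T) => planeCoord a n V y) ⁻¹' interior T, ?_,
    isOpen_interior.preimage (hcont.comp continuous_subtype_val), ?_⟩
  · rintro ⟨y, hy⟩ hyT
    have hy' : y ∈ (affineSpan ℝ T).map (planeAffineMap a n V) := by
      rw [AffineSubspace.map_span]
      exact hy
    obtain ⟨w, -, rfl⟩ := (AffineSubspace.mem_map).1 hy'
    have hyT' : planeCoord a n V (planeMap a n V w) ∈ interior T := hyT
    rw [planeCoord_planeMap hd] at hyT'
    exact mem_image_of_mem _ (interior_subset hyT')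
  · rw [mem_preimage]
    simp only
    rwa [planeCoord_planeMap hd]

theorem zero_mem_interior_triangle {r q : ℝ} {z : ℝ × ℝ} (hr : 0 < r) (hq : 0 < q) (hz1 : z.1 < 0)
    (hz2 : z.2 < 0) : (0 : ℝ × ℝ) ∈ interior (convexHull ℝ {z, (r, 0), (0, q)}) := by
  -- D normalizes the barycentric coordinate of z. Positivity of the three barycentric coordinates
  -- is an open condition satisfied at the origin.
  obtain ⟨D, hD⟩ : ∃ D, D = r * q - z.1 * q - z.2 * r := ⟨_, rfl⟩
  have hrq : 0 < r * q := by positivity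
  have hD0 : 0 < D := by rw [hD]; nlinarith
  rw [mem_interior]
  refine ⟨{w : ℝ × ℝ | 0 < (r * q - q * w.1 - r * w.2) / D ∧
    0 < w.1 - (r * q - q * w.1 - r * w.2) / D * z.1 ∧
    0 < w.2 - (r * q - q * w.1 - r * w.2) / D * z.2}, ?_, ?_, ?_⟩
  · rintro ⟨x, y⟩ ⟨h1, h2, h3⟩
    simp only at h1 h2 h3
    obtain ⟨l, hl⟩ : ∃ l, l = (r * q - q * x - r * y) / D := ⟨_, rfl⟩
    rw [← hl] at h1 h2 h3
    have hlD : l * D = r * q - q * x - r * y := by rw [hl, div_mul_cancel₀ _ hD0.ne']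
    have hsum : l + (x - l * z.1) / r + (y - l * z.2) / q = 1 := by
      field_simp
      rw [hD] at hlD
      linarith
    have hw : (x, y) = l • z + ((x - l * z.1) / r) • (r, (0 : ℝ)) +
        ((y - l * z.2) / q) • ((0 : ℝ), q) := by
      ext <;> simp <;> field_simp <;> ring
    rw [hw]
    have hconv := convex_convexHull ℝ ({z, (r, 0), (0, q)} : Set (ℝ × ℝ))
    have := hconv.sum_mem (t := Finset.univ)
      (w := ![l, (x - l * z.1) / r, (y - l * z.2) / q])
      (z := ![z, (r, 0), (0, q)]) ?_ ?_ ?_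
    · simpa [Fin.sum_univ_three] using this
    · intro i _
      fin_cases i <;> simp <;> positivity
    · simpa [Fin.sum_univ_three] using hsum
    · intro i _
      apply subset_convexHull
      fin_cases i <;> simp
  · refine IsOpen.and ?_ (IsOpen.and ?_ ?_) <;> exact isOpen_lt (by fun_prop) (by fun_prop)
  · have : 0 < r * q / D := by positivity
    refine ⟨by simpa using this, ?_, ?_⟩ <;> simp <;> nlinarith

theorem zero_mem_interior_triangle' {A B z : ℝ × ℝ} (hA : Aligned 0 A) (hB : Aligned 0 B)
    (hA0 : 0 ≤ A) (hB0 : 0 ≤ B) (hAB : ¬ Comparable A B) (hz1 : z.1 < 0) (hz2 : z.2 < 0) :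
    (0 : ℝ × ℝ) ∈ interior (convexHull ℝ {z, A, B}) := by
  obtain ⟨a, a'⟩ := A
  obtain ⟨b, b'⟩ := B
  rw [comparable_iff, not_le] at hAB
  have ha : 0 ≤ a := hA0.1
  have ha' : 0 ≤ a' := hA0.2
  have hb : 0 ≤ b := hB0.1
  have hb' : 0 ≤ b' := hB0.2
  simp only at hAB
  rcases hA with hA | hA <;> rcases hB with hB | hB
  · obtain rfl : a = 0 := hA.symm
    obtain rfl : b = 0 := hB.symm
    simp at hAB
  · obtain rfl : a = 0 := hA.symm
    obtain rfl : b' = 0 := hB.symm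
    rw [pair_comm]
    refine zero_mem_interior_triangle (hb.lt_of_ne ?_) (ha'.lt_of_ne ?_) hz1 hz2 <;>
      (rintro rfl; simp at hAB)
  · obtain rfl : a' = 0 := hA.symm
    obtain rfl : b = 0 := hB.symm
    refine zero_mem_interior_triangle (ha.lt_of_ne ?_) (hb'.lt_of_ne ?_) hz1 hz2 <;>
      (rintro rfl; simp at hAB)
  · obtain rfl : a' = 0 := hA.symm
    obtain rfl : b' = 0 := hB.symm
    simp at hAB

end Wedge

/-! ### Equality of the two hulls for four wells. -/

section MainCases

/-- Two rank-one compatible pairs without common well. -/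
theorem hull_eq_of_disjoint_pairs {Q : Mat} {δ : ℝ} {𝒰 : Set Mat} {V₁ V₂ W₁ W₂ : Mat}
    (h : IsCoplanarWith Q δ 𝒰) (hdet : Q.det < 0) (h𝒰 : 𝒰 = {V₁, V₂, W₁, W₂})
    (hV : RankOneCompatible V₁ V₂) (hW : RankOneCompatible W₁ W₂) :
    symLaminationHull 𝒰 = symQuasiconvexHull 𝒰 := by
  obtain ⟨a, n, hdir⟩ := exists_areRankOneDirections h.normal_symm hdet
  have hd := cross_ne_zero_of_linearIndependent hdir.linearIndependent
  have m1 : V₁ ∈ 𝒰 := by simp [h𝒰]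
  have m2 : V₂ ∈ 𝒰 := by simp [h𝒰]
  have m3 : W₁ ∈ 𝒰 := by simp [h𝒰]
  have m4 : W₂ ∈ 𝒰 := by simp [h𝒰]
  have hinv : ∀ M ∈ 𝒰, planeMap a n V₁ (planeCoord a n V₁ M) = M := fun M hM =>
    planeMap_planeCoord h.normal_symm hdet hd hdir.orthogonal_a hdir.orthogonal_n
      (h.wells_symm _ m1) (h.mem_plane _ m1) (h.wells_symm _ hM) (h.mem_plane _ hM)
  rw [← hinv V₁ m1, ← hinv V₂ m2, rankOneCompatible_planeMap_iff hd] at hV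
  rw [← hinv W₁ m3, ← hinv W₂ m4, rankOneCompatible_planeMap_iff hd] at hW
  refine symLaminationHull_eq_of_determined h hdet (by rw [h𝒰]; exact toFinite _) hdir m1 ?_
  rw [h𝒰, image_insert_eq, image_insert_eq, image_insert_eq, image_singleton]
  exact determined_pairs hV hW

/-- Two rank-one compatible pairs with a common well. -/
theorem hull_eq_of_shared_well {Q : Mat} {δ : ℝ} {𝒰 : Set Mat} {V A B Z : Mat}
    {a n : Fin 2 → ℝ} (hdir : AreRankOneDirections Q a n)
    (h : IsCoplanarWith Q δ 𝒰) (hdet : Q.det < 0) (h𝒰 : 𝒰 = {V, A, B, Z})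
    (hVA : V ≠ A) (hVB : V ≠ B) (hVZ : V ≠ Z) (hAZ : A ≠ Z) (hBZ : B ≠ Z)
    (hA : RankOneCompatible V A) (hB : RankOneCompatible V B) (hwedge : ¬ IsWedge 𝒰)
    (hcomp : Compatible V Z ∨ Compatible A Z ∨ Compatible B Z)
    (hcase : Z ∈ segment ℝ V A ∪ segment ℝ V B ∨ (A ∈ upperCone a n V ∧ B ∈ upperCone a n V)) :
    symLaminationHull 𝒰 = symQuasiconvexHull 𝒰 := by
  have hd := cross_ne_zero_of_linearIndependent hdir.linearIndependent
  have mV : V ∈ 𝒰 := by simp [h𝒰]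
  have mA : A ∈ 𝒰 := by simp [h𝒰]
  have mB : B ∈ 𝒰 := by simp [h𝒰]
  have mZ : Z ∈ 𝒰 := by simp [h𝒰]
  have hVs := h.wells_symm _ mV
  have hinv : ∀ M ∈ 𝒰, planeMap a n V (planeCoord a n V M) = M := fun M hM =>
    planeMap_planeCoord h.normal_symm hdet hd hdir.orthogonal_a hdir.orthogonal_n
      hVs (h.mem_plane _ mV) (h.wells_symm _ hM) (h.mem_plane _ hM)
  have eV : planeCoord a n V V = 0 := by
    have := planeCoord_planeMap (V := V) hd 0
    rwa [planeMap_zero] at this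
  refine symLaminationHull_eq_of_determined h hdet (by rw [h𝒰]; exact toFinite _) hdir mV ?_
  rw [h𝒰, image_insert_eq, image_insert_eq, image_insert_eq, image_singleton, eV]
  have hinvA := hinv A mA
  have hinvB := hinv B mB
  have hinvZ := hinv Z mZ
  generalize planeCoord a n V A = α at *
  generalize planeCoord a n V B = β at *
  generalize planeCoord a n V Z = ζ at *
  have hinvV : planeMap a n V 0 = V := planeMap_zero
  have inj : Function.Injective (planeMap a n V) := fun p q hpq => by
    rw [← planeCoord_planeMap (V := V) hd p, hpq, planeCoord_planeMap hd]
  have hA' : Aligned 0 α := by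
    rwa [← rankOneCompatible_planeMap_iff (V := V) hd, hinvV, hinvA]
  have hB' : Aligned 0 β := by
    rwa [← rankOneCompatible_planeMap_iff (V := V) hd, hinvV, hinvB]
  refine determined_shared hA' hB' ?_ ?_ ?_ ?_ ?_ ?_ ?_
  · rintro rfl; exact hVA (hinvV.symm.trans hinvA)
  · rintro rfl; exact hVB (hinvV.symm.trans hinvB)
  · rintro rfl; exact hVZ (hinvV.symm.trans hinvZ)
  · rintro rfl; exact hAZ (hinvA.symm.trans hinvZ)
  · rintro rfl; exact hBZ (hinvB.symm.trans hinvZ)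
  · rw [← compatible_planeMap_iff hVs hd, ← compatible_planeMap_iff hVs hd,
      ← compatible_planeMap_iff hVs hd, hinvV, hinvA, hinvB, hinvZ]
    exact hcomp
  · rcases hcase with hcase | ⟨hUA, hUB⟩
    · left
      have seg : ∀ {M : Mat} {μ : ℝ × ℝ}, planeMap a n V μ = M → Z ∈ segment ℝ V M →
          ζ ∈ segment ℝ 0 μ := by
        rintro M μ hM ⟨s, t, hs, ht, hst, hZ⟩
        refine ⟨s, t, hs, ht, hst, inj ?_⟩
        rw [hinvZ, ← hZ, ← hM]
        obtain rfl : s = 1 - t := by linarith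
        simp only [planeMap, smul_zero, zero_add, Prod.smul_fst, Prod.smul_snd, smul_eq_mul]
        module
      exact hcase.imp (seg hinvA) (seg hinvB)
    · right
      have cone : ∀ {M : Mat} {μ : ℝ × ℝ}, planeMap a n V μ = M → M ∈ upperCone a n V →
          0 ≤ μ := by
        rintro M μ hM ⟨ξ, η, hξ, hη, hMe⟩
        have : μ = (ξ, -η) := inj (by
          rw [hM, hMe, planeMap]
          simp only
          module)
        rw [this]
        exact ⟨hξ, by simpa using hη⟩
      have hα := cone hinvA hUA
      have hβ := cone hinvB hUB
      refine ⟨hα, hβ, fun hz1 hz2 => ?_⟩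
      -- If the arms are incomparable and Z is in the open third quadrant, Z lies below both arm
      -- ends and V is interior to the triangle of the other three: a wedge with V as its inner
      -- well.
      by_contra hnc
      have hζ : ∀ {μ : ℝ × ℝ}, 0 ≤ μ → Comparable ζ μ := fun hμ =>
        Or.inl (le_trans ⟨hz1.le, hz2.le⟩ hμ)
      refine hwedge ⟨V, Z, A, B, ?_, ?_, ?_, ?_, ?_, hA, hB⟩
      · rw [h𝒰, insert_comm Z, pair_comm Z B]
      · rw [← hinvA, ← hinvZ, compatible_planeMap_iff hVs hd]
        exact hζ hα
      · rw [← hinvB, ← hinvZ, compatible_planeMap_iff hVs hd]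
        exact hζ hβ
      · rwa [← hinvA, ← hinvB, compatible_planeMap_iff hVs hd]
      · have hint := planeMap_mem_intrinsicInterior (V := V) hd
          (zero_mem_interior_triangle' hA' hB' hα hβ hnc hz1 hz2)
        have himg := AffineMap.image_convexHull (planeAffineMap a n V) {ζ, α, β}
        have himg' : planeMap a n V '' convexHull ℝ {ζ, α, β} =
          convexHull ℝ (planeMap a n V '' {ζ, α, β}) := himg
        rw [himg', image_insert_eq, image_insert_eq, image_singleton, hinvV, hinvA, hinvB,
          hinvZ] at hint
        exact hint

theorem RankOneCompatible.symm {A B : Mat} (h : RankOneCompatible A B) : RankOneCompatible B A := by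
  rw [RankOneCompatible, rank_le_one_iff_det_eq_zero] at *
  rw [← neg_sub, Matrix.det_neg, h, mul_zero]

theorem lowerCone_eq (a n : Fin 2 → ℝ) (U : Mat) : lowerCone a n U = upperCone n a U := by
  ext M
  constructor
  · rintro ⟨ξ, η, hξ, hη, rfl⟩
    exact ⟨η, ξ, hη, hξ, by abel⟩
  · rintro ⟨ξ, η, hξ, hη, rfl⟩
    exact ⟨η, ξ, hη, hξ, by abel⟩

theorem Compatible.symm {A B : Mat} (hA : A.IsSymm) (hB : B.IsSymm) (h : Compatible A B) :
    Compatible B A := by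
  rw [compatible_iff hA hB] at h
  rw [compatible_iff hB hA, ← neg_sub, Matrix.det_neg]
  simpa using h

/-- The pair contains `V`; `X` is the other element. -/
theorem exists_pair_eq {α : Type*} {V X Y : α} (h : V ∈ ({X, Y} : Set α)) :
    ∃ A, ({X, Y} : Set α) = {V, A} ∧ ((X = V ∧ Y = A) ∨ (Y = V ∧ X = A)) := by
  rcases h with rfl | h
  · exact ⟨Y, rfl, Or.inl ⟨rfl, rfl⟩⟩
  · obtain rfl : V = Y := h
    exact ⟨X, pair_comm _ _, Or.inr ⟨rfl, rfl⟩⟩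

/-- The split is on whether the pairs share a well. Disjoint pairs exhaust 𝒰. A common well makes D
connected, which excludes the first alternative; the second places the fourth well on D, and the
third places both arms in one cone, with lower cones turned into upper ones by exchanging a and n.
-/
theorem hull_eq_of_fourWells {Q : Mat} {δ : ℝ} {𝒰 : Set Mat} {V₁ V₂ W₁ W₂ : Mat}
    (h : FourWells Q δ 𝒰 V₁ V₂ W₁ W₂)
    (hc : DisconnectedCase V₁ V₂ W₁ W₂ ∨ ConnectedCase 𝒰 V₁ V₂ W₁ W₂ ∨ ConeCase Q V₁ V₂ W₁ W₂) :
    symLaminationHull 𝒰 = symQuasiconvexHull 𝒰 := by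
  have hfin : 𝒰.Finite := finite_of_ncard_ne_zero (by rw [h.card_eq]; norm_num)
  by_cases hdis : (({V₁, V₂} : Set Mat) ∩ {W₁, W₂}).Nonempty
  swap
  · rw [not_nonempty_iff_eq_empty, ← disjoint_iff_inter_eq_empty] at hdis
    refine hull_eq_of_disjoint_pairs h.coplanar h.det_neg ?_ h.V_rankOne h.W_rankOne
    have hu : ({V₁, V₂, W₁, W₂} : Set Mat) = {V₁, V₂} ∪ {W₁, W₂} := by
      rw [insert_union, singleton_union]
    symm
    refine eq_of_subset_of_ncard_le ?_ ?_ hfin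
    · rw [hu]
      exact union_subset h.V_subset h.W_subset
    · rw [hu, ncard_union_eq hdis, ncard_pair h.V_ne, ncard_pair h.W_ne, h.card_eq]
  obtain ⟨V, hVV, hVW⟩ := hdis
  obtain ⟨A, eA, hA⟩ := exists_pair_eq hVV
  obtain ⟨B, eB, hB⟩ := exists_pair_eq hVW
  have hAr : RankOneCompatible V A := by
    rcases hA with ⟨rfl, rfl⟩ | ⟨rfl, rfl⟩
    · exact h.V_rankOne
    · exact h.V_rankOne.symm
  have hBr : RankOneCompatible V B := by
    rcases hB with ⟨rfl, rfl⟩ | ⟨rfl, rfl⟩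
    · exact h.W_rankOne
    · exact h.W_rankOne.symm
  have hVA : V ≠ A := by
    rcases hA with ⟨rfl, rfl⟩ | ⟨rfl, rfl⟩
    · exact h.V_ne
    · exact h.V_ne.symm
  have hVB : V ≠ B := by
    rcases hB with ⟨rfl, rfl⟩ | ⟨rfl, rfl⟩
    · exact h.W_ne
    · exact h.W_ne.symm
  have hAB : A ≠ B := by
    rintro rfl
    exact h.pairs_ne (eA.trans eB.symm)
  have hVs := h.V_subset
  have hWs := h.W_subset
  rw [eA] at hVs
  rw [eB] at hWs
  have mV : V ∈ 𝒰 := hVs (by simp)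
  have mA : A ∈ 𝒰 := hVs (by simp)
  have mB : B ∈ 𝒰 := hWs (by simp)
  have hsub : ({V, A, B} : Set Mat) ⊆ 𝒰 := by
    rintro M (rfl | rfl | rfl) <;> assumption
  have hcard3 : ({V, A, B} : Set Mat).ncard = 3 := ncard_eq_three.2 ⟨V, A, B, hVA, hVB, hAB, rfl⟩
  obtain ⟨Z, mZ, hZ⟩ : ∃ Z ∈ 𝒰, Z ∉ ({V, A, B} : Set Mat) :=
    exists_mem_notMem_of_ncard_lt_ncard (by rw [hcard3, h.card_eq]; norm_num) (toFinite _)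
  have h𝒰 : 𝒰 = {V, A, B, Z} := by
    have hi : ({V, A, B, Z} : Set Mat) = insert Z {V, A, B} := by
      ext M
      simp only [mem_insert_iff, mem_singleton_iff]
      tauto
    rw [hi]
    symm
    refine eq_of_subset_of_ncard_le (insert_subset mZ hsub) ?_ hfin
    rw [ncard_insert_of_notMem hZ, hcard3, h.card_eq]
  simp only [mem_insert_iff, mem_singleton_iff, not_or] at hZ
  obtain ⟨hZV, hZA, hZB⟩ := hZ
  have hsymm := h.coplanar.wells_symm
  have hcomp : Compatible V Z ∨ Compatible A Z ∨ Compatible B Z := by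
    obtain ⟨M, hM, hne, hMZ⟩ := h.exists_compatible Z mZ
    have hMZ' := hMZ.symm (hsymm Z mZ) (hsymm M hM)
    rw [h𝒰] at hM
    rcases hM with rfl | rfl | rfl | rfl
    · exact Or.inl hMZ'
    · exact Or.inr (Or.inl hMZ')
    · exact Or.inr (Or.inr hMZ')
    · exact absurd rfl hne
  have hseg : twoSegments V₁ V₂ W₁ W₂ = segment ℝ V B ∪ segment ℝ V A := by
    rw [twoSegments, eA, eB, convexHull_pair, convexHull_pair]
  have hconn : IsConnected (twoSegments V₁ V₂ W₁ W₂) := by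
    rw [hseg]
    exact IsConnected.union ⟨V, left_mem_segment ℝ V B, left_mem_segment ℝ V A⟩
      ((convex_segment V B).isConnected ⟨V, left_mem_segment ℝ V B⟩)
      ((convex_segment V A).isConnected ⟨V, left_mem_segment ℝ V A⟩)
  rcases hc with hc | hc | hc
  · exact absurd hconn hc
  · obtain ⟨a, n, hdir⟩ := exists_areRankOneDirections h.coplanar.normal_symm h.det_neg
    refine hull_eq_of_shared_well hdir h.coplanar h.det_neg h𝒰 hVA hVB (Ne.symm hZV) (Ne.symm hZA)
      (Ne.symm hZB) hAr hBr h.not_wedge hcomp (Or.inl ?_)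
    have := hc.2 mZ
    rwa [hseg, union_comm] at this
  · obtain ⟨V', hV', a, n, hdir, hcone⟩ := hc
    have hVV' : V ∈ ({V'} : Set Mat) := hV' ▸ ⟨hVV, hVW⟩
    obtain rfl : V = V' := hVV'
    have mA' : A ∈ twoSegments V₁ V₂ W₁ W₂ := by
      rw [hseg]; exact Or.inr (right_mem_segment ℝ V A)
    have mB' : B ∈ twoSegments V₁ V₂ W₁ W₂ := by
      rw [hseg]; exact Or.inl (right_mem_segment ℝ V B)
    rcases hcone with hcone | hcone
    · exact hull_eq_of_shared_well hdir h.coplanar h.det_neg h𝒰 hVA hVB (Ne.symm hZV)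
        (Ne.symm hZA) (Ne.symm hZB) hAr hBr h.not_wedge hcomp (Or.inr ⟨hcone mA', hcone mB'⟩)
    · rw [lowerCone_eq] at hcone
      exact hull_eq_of_shared_well hdir.swap h.coplanar h.det_neg h𝒰 hVA hVB (Ne.symm hZV)
        (Ne.symm hZA) (Ne.symm hZB) hAr hBr h.not_wedge hcomp (Or.inr ⟨hcone mA', hcone mB'⟩)

end MainCases

/-! ### Diagonal examples with strict inclusion in the convex hull. -/

section Examples

/-- The diagonal matrix with entries `p.1` and `-p.2`. -/
noncomputable def diagMat (p : ℝ × ℝ) : Mat := planeMap ![0, 1] ![1, 0] 0 p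

theorem cross_diag : cross ![0, 1] ![1, 0] ≠ 0 := by simp [cross]

theorem diagMat_injective : Function.Injective diagMat := fun p q hpq => by
  rw [← planeCoord_planeMap (V := 0) cross_diag p, ← planeCoord_planeMap (V := 0) cross_diag q]
  exact congrArg _ hpq

theorem diagMat_apply (p : ℝ × ℝ) : diagMat p 0 0 = p.1 ∧ diagMat p 0 1 = 0 ∧ diagMat p 1 0 = 0 ∧
    diagMat p 1 1 = -p.2 := by
  obtain ⟨a00, a01, a10, a11⟩ := perpTensor_apply ![0, 1]
  obtain ⟨n00, n01, n10, n11⟩ := perpTensor_apply ![1, 0]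
  simp [diagMat, planeMap_apply, a00, a01, a10, a11, n00, n01, n10, n11]

theorem areRankOneDirections_diag : AreRankOneDirections !![0, 1; 1, 0] ![0, 1] ![1, 0] := by
  refine ⟨by simp [dotProduct], by simp [dotProduct], linearIndependent_of_cross_ne_zero cross_diag,
    ?_, ?_⟩ <;> simp [frobInner_eq, perpTensor_apply]

theorem compatible_diagMat_iff {p q : ℝ × ℝ} : Compatible (diagMat p) (diagMat q) ↔
    Comparable p q :=
  compatible_planeMap_iff (by simp [Matrix.IsSymm]) cross_diag

theorem rankOneCompatible_diagMat_iff {p q : ℝ × ℝ} :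
    RankOneCompatible (diagMat p) (diagMat q) ↔ Aligned p q :=
  rankOneCompatible_planeMap_iff cross_diag

theorem segment_diagMat (p q : ℝ × ℝ) :
    segment ℝ (diagMat p) (diagMat q) = diagMat '' segment ℝ p q :=
  (image_segment ℝ (planeAffineMap ![0, 1] ![1, 0] 0) p q).symm

theorem convexHull_diagMat (S : Set (ℝ × ℝ)) :
    convexHull ℝ (diagMat '' S) = diagMat '' convexHull ℝ S :=
  (AffineMap.image_convexHull (planeAffineMap ![0, 1] ![1, 0] 0) S).symm

theorem twoSegments_diagMat (v₁ v₂ w₁ w₂ : ℝ × ℝ) :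
    twoSegments (diagMat v₁) (diagMat v₂) (diagMat w₁) (diagMat w₂) =
      diagMat '' (segment ℝ w₁ w₂ ∪ segment ℝ v₁ v₂) := by
  rw [twoSegments, convexHull_pair, convexHull_pair, segment_diagMat, segment_diagMat, image_union]

theorem hull_ssubset_of_not_isOuter {S : Set (ℝ × ℝ)} (hS : S.Finite) {z : ℝ × ℝ}
    (hz : z ∈ convexHull ℝ S) (x₀ y₀ c : ℝ) (hle : ∀ s ∈ S, (s.1 - x₀) * (s.2 - y₀) ≤ c)
    (hlt : c < (z.1 - x₀) * (z.2 - y₀)) :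
    symLaminationHull (diagMat '' S) ⊂ convexHull ℝ (diagMat '' S) := by
  refine (ssubset_iff_of_subset (symLaminationHull_subset_convexHull _)).2 ⟨diagMat z, ?_, ?_⟩
  · rw [convexHull_diagMat]
    exact mem_image_of_mem _ hz
  · intro hmem
    have hV : (0 : Mat).IsSymm := by simp [Matrix.IsSymm]
    have hq := symLaminationHull_subset_symQuasiconvexHull (by
      rintro _ ⟨p, -, rfl⟩
      exact isSymm_planeMap hV p) hmem
    have := (isOuter_of_mem_symQuasiconvexHull hV cross_diag hS hq).le x₀ y₀ c hle
    linarith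

/-- Wells in convex position are not in a wedge configuration. -/
theorem not_isWedge_diagMat {S : Set (ℝ × ℝ)} (hcard : S.ncard = 4)
    (hpos : ∀ p ∈ S, ∃ r s : ℝ, ∀ q ∈ S, q ≠ p → r * q.1 + s * q.2 < r * p.1 + s * p.2) :
    ¬ IsWedge (diagMat '' S) := by
  rintro ⟨U₀, U₁, U₂, U₃, hU, -, -, -, hint, -, -⟩
  have hcard' : (diagMat '' S).ncard = 4 := by
    rw [ncard_image_of_injective _ diagMat_injective, hcard]
  have hnot : U₀ ∉ ({U₁, U₂, U₃} : Set Mat) := by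
    intro h
    rw [hU, insert_eq_of_mem h] at hcard'
    have h1 := ncard_insert_le U₁ {U₂, U₃}
    have h2 := ncard_insert_le U₂ {U₃}
    rw [ncard_singleton] at h2
    omega
  have hm : U₀ ∈ diagMat '' S := by simp [hU]
  obtain ⟨p, hp, rfl⟩ := hm
  obtain ⟨r, s, hrs⟩ := hpos p hp
  -- The strict supporting line at p becomes an open half-space containing the other three wells but
  -- not U₀. The minus sign reflects that `diagMat` negates the second coordinate.
  have hconv : Convex ℝ {M : Mat | r * M 0 0 - s * M 1 1 < r * p.1 + s * p.2} := by
    intro A hA B hB u v hu hv huv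
    simp only [mem_ofPred_eq, Matrix.add_apply, Matrix.smul_apply, smul_eq_mul] at *
    have e : r * p.1 + s * p.2 = u * (r * p.1 + s * p.2) + v * (r * p.1 + s * p.2) := by
      rw [← add_mul, huv, one_mul]
    rw [e]
    rcases eq_or_lt_of_le hu with rfl | hu
    · obtain rfl : v = 1 := by linarith
      linarith
    · nlinarith [mul_lt_mul_of_pos_left hA hu, mul_le_mul_of_nonneg_left hB.le hv]
  have hsub : ({U₁, U₂, U₃} : Set Mat) ⊆ {M : Mat | r * M 0 0 - s * M 1 1 < r * p.1 + s * p.2} := by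
    intro M hM
    have hMS : M ∈ diagMat '' S := by rw [hU]; exact Or.inr hM
    obtain ⟨q, hq, rfl⟩ := hMS
    have hqp : q ≠ p := by
      rintro rfl
      exact hnot hM
    obtain ⟨q0, -, -, q1⟩ := diagMat_apply q
    have := hrs q hq hqp
    rw [mem_ofPred_eq, q0, q1]
    linarith
  have := convexHull_min hsub hconv (intrinsicInterior_subset hint)
  obtain ⟨p0, -, -, p1⟩ := diagMat_apply p
  rw [mem_ofPred_eq, p0, p1] at this
  linarith

theorem fourWells_diagMat {S : Set (ℝ × ℝ)} {v₁ v₂ w₁ w₂ : ℝ × ℝ} (hcard : S.ncard = 4)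
    (hcomp : ∀ p ∈ S, ∃ q ∈ S, q ≠ p ∧ Aligned p q)
    (hpos : ∀ p ∈ S, ∃ r s : ℝ, ∀ q ∈ S, q ≠ p → r * q.1 + s * q.2 < r * p.1 + s * p.2)
    (hv₁ : v₁ ∈ S) (hv₂ : v₂ ∈ S) (hw₁ : w₁ ∈ S) (hw₂ : w₂ ∈ S) (hv : v₁ ≠ v₂) (hw : w₁ ≠ w₂)
    (hvw : v₂ ≠ w₁ ∧ v₂ ≠ w₂) (hv' : Aligned v₁ v₂) (hw' : Aligned w₁ w₂) :
    FourWells !![0, 1; 1, 0] 0 (diagMat '' S) (diagMat v₁) (diagMat v₂) (diagMat w₁)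
      (diagMat w₂) where
  card_eq := by rw [ncard_image_of_injective _ diagMat_injective, hcard]
  coplanar := by
    refine ⟨?_, ?_, ?_⟩
    · ext i j
      fin_cases i <;> fin_cases j <;> simp
    · rintro _ ⟨p, -, rfl⟩
      exact isSymm_planeMap (by simp [Matrix.IsSymm]) p
    · rintro _ ⟨p, -, rfl⟩
      simp [frobInner_eq, diagMat_apply]
  det_neg := by simp [Matrix.det_fin_two]
  exists_compatible := by
    rintro _ ⟨p, hp, rfl⟩
    obtain ⟨q, hq, hqp, hal⟩ := hcomp p hp
    refine ⟨diagMat q, mem_image_of_mem _ hq, diagMat_injective.ne hqp, ?_⟩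
    rw [compatible_diagMat_iff, comparable_iff]
    rcases hal with h | h <;> rw [h] <;> simp
  not_wedge := not_isWedge_diagMat hcard hpos
  V_subset := by
    rintro _ (rfl | rfl)
    · exact mem_image_of_mem _ hv₁
    · exact mem_image_of_mem _ hv₂
  W_subset := by
    rintro _ (rfl | rfl)
    · exact mem_image_of_mem _ hw₁
    · exact mem_image_of_mem _ hw₂
  V_ne := diagMat_injective.ne hv
  W_ne := diagMat_injective.ne hw
  pairs_ne := by
    intro h
    have : diagMat v₂ ∈ ({diagMat w₁, diagMat w₂} : Set Mat) := by rw [← h]; simp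
    rcases this with h | h
    · exact hvw.1 (diagMat_injective h)
    · exact hvw.2 (diagMat_injective h)
  V_rankOne := rankOneCompatible_diagMat_iff.2 hv'
  W_rankOne := rankOneCompatible_diagMat_iff.2 hw'

theorem ncard_four {α : Type*} {p q r s : α} (h1 : p ≠ q) (h2 : p ≠ r) (h3 : p ≠ s) (h4 : q ≠ r)
    (h5 : q ≠ s) (h6 : r ≠ s) : ({p, q, r, s} : Set α).ncard = 4 := by
  rw [ncard_insert_of_notMem (by simp [h1, h2, h3]), ncard_insert_of_notMem (by simp [h4, h5]),
    ncard_pair h6]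

theorem midpoint_mem_convexHull {S : Set (ℝ × ℝ)} {p q z : ℝ × ℝ} (hp : p ∈ S) (hq : q ∈ S)
    (h1 : z.1 = (p.1 + q.1) / 2) (h2 : z.2 = (p.2 + q.2) / 2) : z ∈ convexHull ℝ S := by
  refine segment_subset_convexHull hp hq ⟨1 / 2, 1 / 2, by norm_num, by norm_num, by norm_num, ?_⟩
  ext
  · simp [h1]; ring
  · simp [h2]; ring

theorem exists_disconnected_example : ∃ (Q : Mat) (δ : ℝ) (𝒰 : Set Mat) (V₁ V₂ W₁ W₂ : Mat),
    FourWells Q δ 𝒰 V₁ V₂ W₁ W₂ ∧ DisconnectedCase V₁ V₂ W₁ W₂ ∧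
      symLaminationHull 𝒰 ⊂ convexHull ℝ 𝒰 := by
  refine ⟨!![0, 1; 1, 0], 0, diagMat '' {(0, 0), (1, 0), (2, -1), (3, -1)}, diagMat (0, 0),
    diagMat (1, 0), diagMat (2, -1), diagMat (3, -1), ?_, ?_, ?_⟩
  · refine fourWells_diagMat ?_ ?_ ?_ (by simp) (by simp) (by simp) (by simp) (by simp)
      (by norm_num) (by norm_num) (Or.inr rfl) (Or.inr rfl)
    · apply ncard_four <;> norm_num
    · rintro p (rfl | rfl | rfl | rfl)
      · exact ⟨(1, 0), by simp, by norm_num, Or.inr rfl⟩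
      · exact ⟨(0, 0), by simp, by norm_num, Or.inr rfl⟩
      · exact ⟨(3, -1), by simp, by norm_num, Or.inr rfl⟩
      · exact ⟨(2, -1), by simp, by norm_num, Or.inr rfl⟩
    · rintro p (rfl | rfl | rfl | rfl)
      · exact ⟨-1, 0, by rintro q (rfl | rfl | rfl | rfl) h <;> first | exact absurd rfl h | norm_num⟩
      · exact ⟨1, 3, by rintro q (rfl | rfl | rfl | rfl) h <;> first | exact absurd rfl h | norm_num⟩
      · exact ⟨-1, -3, by rintro q (rfl | rfl | rfl | rfl) h <;> first | exact absurd rfl h | norm_num⟩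
      · exact ⟨1, 0, by rintro q (rfl | rfl | rfl | rfl) h <;> first | exact absurd rfl h | norm_num⟩
  · rw [DisconnectedCase, twoSegments_diagMat]
    intro h
    -- On D the first diagonal entry takes values in [0, 1] and [2, 3] only, so 3 / 2 disproves
    -- connectedness.
    have hc : ContinuousOn (fun M : Mat => M 0 0)
        (diagMat '' (segment ℝ (2, -1) (3, -1) ∪ segment ℝ (0, 0) (1, 0))) := by fun_prop
    have hiv := h.isPreconnected.intermediate_value
      (mem_image_of_mem _ (Or.inr (left_mem_segment ℝ _ _)))
      (mem_image_of_mem _ (Or.inl (left_mem_segment ℝ _ _))) hc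
    simp only [diagMat_apply] at hiv
    obtain ⟨M, ⟨p, hp, rfl⟩, hM⟩ := hiv (show (3 / 2 : ℝ) ∈ Icc 0 2 by norm_num)
    simp only [diagMat_apply] at hM
    rcases hp with ⟨s, t, hs, ht, hst, rfl⟩ | ⟨s, t, hs, ht, hst, rfl⟩
    · simp at hM
      linarith
    · simp at hM
      linarith
  -- (x - 2)y is nonpositive at the wells and equals 1 / 4 at this midpoint.
  · refine hull_ssubset_of_not_isOuter (toFinite _) (z := (3 / 2, -1 / 2))
      (midpoint_mem_convexHull (p := (0, 0)) (q := (3, -1)) (by simp) (by simp) (by norm_num)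
        (by norm_num)) 2 0 0 ?_ (by norm_num)
    rintro s (rfl | rfl | rfl | rfl) <;> norm_num

theorem exists_connected_example : ∃ (Q : Mat) (δ : ℝ) (𝒰 : Set Mat) (V₁ V₂ W₁ W₂ : Mat),
    FourWells Q δ 𝒰 V₁ V₂ W₁ W₂ ∧ ConnectedCase 𝒰 V₁ V₂ W₁ W₂ ∧
      symLaminationHull 𝒰 ⊂ convexHull ℝ 𝒰 := by
  refine ⟨!![0, 1; 1, 0], 0, diagMat '' {(-1, 0), (1, 0), (0, -1), (0, 1)}, diagMat (-1, 0),
    diagMat (1, 0), diagMat (0, -1), diagMat (0, 1), ?_, ⟨?_, ?_⟩, ?_⟩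
  · refine fourWells_diagMat ?_ ?_ ?_ (by simp) (by simp) (by simp) (by simp) (by norm_num)
      (by norm_num) (by norm_num) (Or.inr rfl) (Or.inl rfl)
    · apply ncard_four <;> norm_num
    · rintro p (rfl | rfl | rfl | rfl)
      · exact ⟨(1, 0), by simp, by norm_num, Or.inr rfl⟩
      · exact ⟨(-1, 0), by simp, by norm_num, Or.inr rfl⟩
      · exact ⟨(0, 1), by simp, by norm_num, Or.inl rfl⟩
      · exact ⟨(0, -1), by simp, by norm_num, Or.inl rfl⟩
    · rintro p (rfl | rfl | rfl | rfl)
      · exact ⟨-1, 0, by rintro q (rfl | rfl | rfl | rfl) h <;> first | exact absurd rfl h | norm_num⟩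
      · exact ⟨1, 0, by rintro q (rfl | rfl | rfl | rfl) h <;> first | exact absurd rfl h | norm_num⟩
      · exact ⟨0, -1, by rintro q (rfl | rfl | rfl | rfl) h <;> first | exact absurd rfl h | norm_num⟩
      · exact ⟨0, 1, by rintro q (rfl | rfl | rfl | rfl) h <;> first | exact absurd rfl h | norm_num⟩
  · rw [twoSegments, convexHull_pair, convexHull_pair]
    refine IsConnected.union ⟨diagMat 0, ?_, ?_⟩
      ((convex_segment _ _).isConnected ⟨_, left_mem_segment ℝ _ _⟩)
      ((convex_segment _ _).isConnected ⟨_, left_mem_segment ℝ _ _⟩)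
    all_goals
      rw [segment_diagMat]
      refine mem_image_of_mem _ ⟨1 / 2, 1 / 2, by norm_num, by norm_num, by norm_num, ?_⟩
      ext <;> simp
  · rw [twoSegments_diagMat]
    refine image_mono ?_
    rintro p (rfl | rfl | rfl | rfl)
    · exact Or.inr (left_mem_segment ℝ _ _)
    · exact Or.inr (right_mem_segment ℝ _ _)
    · exact Or.inl (left_mem_segment ℝ _ _)
    · exact Or.inl (right_mem_segment ℝ _ _)
  -- xy vanishes at the wells and is positive at this midpoint.
  · refine hull_ssubset_of_not_isOuter (toFinite _) (z := (1 / 2, 1 / 2))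
      (midpoint_mem_convexHull (p := (1, 0)) (q := (0, 1)) (by simp) (by simp) (by norm_num)
        (by norm_num)) 0 0 0 ?_ (by norm_num)
    rintro s (rfl | rfl | rfl | rfl) <;> norm_num

theorem exists_cone_example : ∃ (Q : Mat) (δ : ℝ) (𝒰 : Set Mat) (V₁ V₂ W₁ W₂ : Mat),
    FourWells Q δ 𝒰 V₁ V₂ W₁ W₂ ∧ ConeCase Q V₁ V₂ W₁ W₂ ∧
      symLaminationHull 𝒰 ⊂ convexHull ℝ 𝒰 := by
  refine ⟨!![0, 1; 1, 0], 0, diagMat '' {(0, 0), (2, 0), (0, 2), (2, 1)}, diagMat (0, 0),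
    diagMat (2, 0), diagMat (0, 0), diagMat (0, 2), ?_, ⟨diagMat (0, 0), ?_, ![0, 1], ![1, 0],
      areRankOneDirections_diag, Or.inl ?_⟩, ?_⟩
  · refine fourWells_diagMat ?_ ?_ ?_ (by simp) (by simp) (by simp) (by simp) (by norm_num)
      (by norm_num) (by norm_num) (Or.inr rfl) (Or.inl rfl)
    · apply ncard_four <;> norm_num
    · rintro p (rfl | rfl | rfl | rfl)
      · exact ⟨(2, 0), by simp, by norm_num, Or.inr rfl⟩
      · exact ⟨(0, 0), by simp, by norm_num, Or.inr rfl⟩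
      · exact ⟨(0, 0), by simp, by norm_num, Or.inl rfl⟩
      · exact ⟨(2, 0), by simp, by norm_num, Or.inl rfl⟩
    · rintro p (rfl | rfl | rfl | rfl)
      · exact ⟨-1, -1, by rintro q (rfl | rfl | rfl | rfl) h <;> first | exact absurd rfl h | norm_num⟩
      · exact ⟨1, -1, by rintro q (rfl | rfl | rfl | rfl) h <;> first | exact absurd rfl h | norm_num⟩
      · exact ⟨-1, 1, by rintro q (rfl | rfl | rfl | rfl) h <;> first | exact absurd rfl h | norm_num⟩
      · exact ⟨2, 2, by rintro q (rfl | rfl | rfl | rfl) h <;> first | exact absurd rfl h | norm_num⟩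
  · ext M
    simp only [mem_inter_iff, mem_insert_iff, mem_singleton_iff]
    constructor
    · rintro ⟨rfl | rfl, h | h⟩
      · rfl
      · rfl
      · exact h
      · have := diagMat_injective h
        norm_num at this
    · rintro rfl
      simp
  · rw [twoSegments_diagMat]
    have hcone : ∀ p : ℝ × ℝ, 0 ≤ p.1 → 0 ≤ p.2 →
        diagMat p ∈ upperCone ![0, 1] ![1, 0] (diagMat (0, 0)) := by
      intro p h1 h2
      refine ⟨p.1, -p.2, h1, by linarith, ?_⟩
      simp only [diagMat, planeMap]
      module
    rintro _ ⟨p, ⟨s, t, hs, ht, hst, rfl⟩ | ⟨s, t, hs, ht, hst, rfl⟩, rfl⟩ <;>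
      apply hcone <;> simp <;> linarith
  -- x(y - 1) is nonpositive at the wells and equals 1 / 2 at this midpoint.
  · refine hull_ssubset_of_not_isOuter (toFinite _) (z := (1, 3 / 2))
      (midpoint_mem_convexHull (p := (0, 2)) (q := (2, 1)) (by simp) (by simp) (by norm_num)
        (by norm_num)) 0 1 0 ?_ (by norm_num)
    rintro s (rfl | rfl | rfl | rfl) <;> norm_num

end Examples

/-- Four coplanar wells: `L^e(𝒰) = Q^e(𝒰)` in each of the three cases, and in each of them there
are examples in which this set is strictly contained in the convex hull of `𝒰`. -/
theorem theorem2 :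
    (∀ (Q : Mat) (δ : ℝ) (𝒰 : Set Mat) (V₁ V₂ W₁ W₂ : Mat),
      FourWells Q δ 𝒰 V₁ V₂ W₁ W₂ →
      (DisconnectedCase V₁ V₂ W₁ W₂ ∨ ConnectedCase 𝒰 V₁ V₂ W₁ W₂ ∨ ConeCase Q V₁ V₂ W₁ W₂) →
      symLaminationHull 𝒰 = symQuasiconvexHull 𝒰) ∧
    (∃ (Q : Mat) (δ : ℝ) (𝒰 : Set Mat) (V₁ V₂ W₁ W₂ : Mat),
      FourWells Q δ 𝒰 V₁ V₂ W₁ W₂ ∧ DisconnectedCase V₁ V₂ W₁ W₂ ∧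
      symLaminationHull 𝒰 ⊂ convexHull ℝ 𝒰) ∧
    (∃ (Q : Mat) (δ : ℝ) (𝒰 : Set Mat) (V₁ V₂ W₁ W₂ : Mat),
      FourWells Q δ 𝒰 V₁ V₂ W₁ W₂ ∧ ConnectedCase 𝒰 V₁ V₂ W₁ W₂ ∧
      symLaminationHull 𝒰 ⊂ convexHull ℝ 𝒰) ∧
    (∃ (Q : Mat) (δ : ℝ) (𝒰 : Set Mat) (V₁ V₂ W₁ W₂ : Mat),
      FourWells Q δ 𝒰 V₁ V₂ W₁ W₂ ∧ ConeCase Q V₁ V₂ W₁ W₂ ∧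
      symLaminationHull 𝒰 ⊂ convexHull ℝ 𝒰) := by
  refine ⟨fun Q δ 𝒰 V₁ V₂ W₁ W₂ h hc => hull_eq_of_fourWells h hc, exists_disconnected_example,
    exists_connected_example, exists_cone_example⟩
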